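/- **Setting.** Let $K\ge 2$ and let $\nu=(\nu_k)_{k\in[K]}$ be probability distributions on $\mathbb R$ with means $\mu=(\mu_k)_{k\in[K]}$, each $1$-sub-Gaussian: $\mathbb E_{X\sim\nu_k}[e^{\lambda(X-\mu_k)}]\le e^{\lambda^2/2}$ for all $\lambda\in\mathbb R$. Put $\mu_\star=\max_k\mu_k$, let $C_\mu=|\{\mu_k: k\in[K]\}|$, let $0=\Delta_1<\Delta_2<\dots<\Delta_{C_\mu}$ be the distinct values of $\mu_\star-\mu_k$, let $\mathcal C_\mu(i)=\{k:\mu_\star-\mu_k=\Delta_i\}$ and $i^\star(\mu)=\{k:\mu_k=\mu_\star\}$. Let $\epsilon_0>0$. **Algorithm.** EB-TC$_{\epsilon_0}$ with fixed proportion $\beta=1/2$ pulls every arm once in rounds $1,\dots,K$. In round $n>K$ let $N_{n,i}$ and $\mu_{n,i}$ be the number of pulls and the empirical mean of arm $i$ over rounds $1,\dots,n-1$. The leader is $B_n=\hat\imath_n\in\arg\max_i\mu_{n,i}$, the challenger is $C_n\in\arg\min_{i\neq B_n}\frac{\mu_{n,B_n}-\mu_{n,i}+\epsilon_0}{\sqrt{1/N_{n,B_n}+1/N_{n,i}}}$,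 and ties are broken arbitrarily, on the basis of the past and possibly of additional randomization. Let $T_{n}(i,j)$ be the number of rounds $t$ with $K<t<n$ and $(B_t,C_t)=(i,j)$, and $N^i_{n,j}$ the number of those in which $j$ was pulled. The algorithm pulls $C_n$ if $N^{B_n}_{n,C_n}\le\frac12T_{n+1}(B_n,C_n)$, and $B_n$ otherwise; given the past, the reward is drawn from the distribution of the pulled arm. It recommends $\hat\imath_n$ at time $n$. **Complexities.** Let $p(x)=x-\log x$, $c_i=\frac{2}{\Delta_i}-\frac1{\epsilon_0}$ and $c_{i,j}=2\,\frac{\Delta_j/\epsilon_0+1}{\Delta_i-\Delta_j}+\frac{3}{\epsilon_0}$. For $i\in[C_\mu-1]$ let $H_i(\mu,\epsilon_0)=\min_{j\in[i]}\max\{\bar H_{i,j},\tilde H_{i,j}\}$, where $$\bar H_{i,j}=|i^\star(\mu)|\max\Big\{\tfrac{\sqrt2}{\Delta_{j+1}},c_{i+1,j}\Big\}^2+\max\{c_{j+1},c_{i+1,j}\}^2\Big(\sum_{k=2}^{j}|\mathcal C_\mu(k)|+\sum_{k=i+1}^{C_\mu}|\mathcal C_\mu(k)|\Big)+\sum_{k=j+1}^{i}|\mathcal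 C_\mu(k)|\max\Big\{c_{j+1},c_{i+1,j},\tfrac{\sqrt2}{\Delta_k}\Big\}^2,$$ $$\tilde H_{i,j}=\frac{2|i^\star(\mu)|}{\Delta_{j+1}^2}+\max\Big\{c_{j+1},\tfrac1{\epsilon_0}\Big\}^2\sum_{k=2}^{j}|\mathcal C_\mu(k)|+\frac{2\sum_{k=1}^{j}|\mathcal C_\mu(k)|}{(\Delta_{i+1}-\Delta_j)^2}+\sum_{k=j+1}^{C_\mu}|\mathcal C_\mu(k)|\max\Big\{c_{j+1},\tfrac1{\epsilon_0},\tfrac{\sqrt2}{\Delta_k}\Big\}^2.$$ **Claim.** (a) If $C_\mu\ge2$, then $H_1(\mu,\epsilon_0)=K\big(\frac2{\Delta_2}+\frac3{\epsilon_0}\big)^2$. For $2\le i\le C_\mu-1$, $\;2K\Delta_{i+1}^{-2}\le H_i(\mu,\epsilon_0)\le\frac32K\min_{j\in[i]}\max\{\frac{2}{\Delta_{j+1}},c_{i+1,j}\}^2$. (b) For every integer $n>5K^2/2$, with $x_i=\frac{n-5K^2/2}{8H_i(\mu,\epsilon_0)}$, $$\mathbb E_\nu[\mu_\star-\mu_{\hat\imath_n}]\le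 K^2e^2(2+\log n)^2\sum_{i\in[C_\mu-1]}(\Delta_{i+1}-\Delta_i)\exp\big(-p(\max\{1,x_i\})\big).$$ (c) In particular, for every integer $n>5K^2/2$ such that $n\ge 5K^2/2+8H_i(\mu,\epsilon_0)$ for all $i\in[C_\mu-1]$, $$\mathbb E_\nu[\mu_\star-\mu_{\hat\imath_n}]\le K^2e^2(2+\log n)^2\sum_{i\in[C_\mu-1]}(\Delta_{i+1}-\Delta_i)\exp\Big(-p\Big(\frac{n-5K^2/2}{8H_i(\mu,\epsilon_0)}\Big)\Big).$$ -/

import Mathlib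

open MeasureTheory ProbabilityTheory

noncomputable section

namespace EBTC

/-! ### Bandit instances: means, gaps, classes of arms -/

/-- The mean of each arm of the instance `ν`. -/
def armMean {K : ℕ} (ν : Fin K → Measure ℝ) (k : Fin K) : ℝ := ∫ x, x ∂(ν k)

/-- A probability distribution on `ℝ` is 1-sub-Gaussian when its centred version has a moment
generating function that is finite and bounded by `exp (t ^ 2 / 2)` everywhere. -/
def IsOneSubGaussian (ρ : Measure ℝ) : Prop :=
  HasSubgaussianMGF (fun x : ℝ => x - ∫ y, y ∂ρ) 1 ρ

/-- The largest mean `μ⋆`. -/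
def bestMean {K : ℕ} (μ : Fin K → ℝ) : ℝ := ⨆ k, μ k

/-- `C_μ`, the number of distinct arm means. -/
def numClasses {K : ℕ} (μ : Fin K → ℝ) : ℕ := (Finset.univ.image μ).card

/-- The finite set of values taken by the gaps `μ⋆ - μ_k`. -/
def gapValues {K : ℕ} (μ : Fin K → ℝ) : Finset ℝ :=
  Finset.univ.image fun k => bestMean μ - μ k

/-- `Δ_i`, the `i`-th smallest gap value (`i = 1, …, C_μ`), so that
`0 = Δ_1 < Δ_2 < ⋯ < Δ_{C_μ}`. The value is irrelevant for `i` outside this range. -/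
def gap {K : ℕ} (μ : Fin K → ℝ) (i : ℕ) : ℝ :=
  ((gapValues μ).sort (· ≤ ·)).getD (i - 1) 0

/-- The number of arms in the class `𝒞_μ(i)` of arms whose gap is `Δ_i`. -/
def classCard {K : ℕ} (μ : Fin K → ℝ) (i : ℕ) : ℕ :=
  (Finset.univ.filter fun k => bestMean μ - μ k = gap μ i).card

/-- The number `|i⋆(μ)|` of arms with the largest mean. -/
def numBest {K : ℕ} (μ : Fin K → ℝ) : ℕ :=
  (Finset.univ.filter fun k => μ k = bestMean μ).card

/-! ### Complexities -/

/-- `C_i(ε₀) = 2 / Δ_i - 1 / ε₀`. -/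
def cOne {K : ℕ} (μ : Fin K → ℝ) (ε₀ : ℝ) (i : ℕ) : ℝ := 2 / gap μ i - 1 / ε₀

/-- `C_{i,j}(ε₀) = 2 (Δ_j / ε₀ + 1) / (Δ_i - Δ_j) + 3 / ε₀`. -/
def cTwo {K : ℕ} (μ : Fin K → ℝ) (ε₀ : ℝ) (i j : ℕ) : ℝ :=
  2 * ((gap μ j / ε₀ + 1) / (gap μ i - gap μ j)) + 3 / ε₀

/-- The complexity `H̄_{i,j}(μ, ε₀)`. -/
def hBar {K : ℕ} (μ : Fin K → ℝ) (ε₀ : ℝ) (i j : ℕ) : ℝ :=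
  numBest μ * (max (√2 / gap μ (j + 1)) (cTwo μ ε₀ (i + 1) j)) ^ 2
  + (max (cOne μ ε₀ (j + 1)) (cTwo μ ε₀ (i + 1) j)) ^ 2
      * ((∑ k ∈ Finset.Icc 2 j, (classCard μ k : ℝ))
        + ∑ k ∈ Finset.Icc (i + 1) (numClasses μ), (classCard μ k : ℝ))
  + ∑ k ∈ Finset.Icc (j + 1) i, (classCard μ k : ℝ)
      * (max (max (cOne μ ε₀ (j + 1)) (cTwo μ ε₀ (i + 1) j)) (√2 / gap μ k)) ^ 2

/-- The complexity `H̃_{i,j}(μ, ε₀)`. -/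
def hTilde {K : ℕ} (μ : Fin K → ℝ) (ε₀ : ℝ) (i j : ℕ) : ℝ :=
  2 * numBest μ / gap μ (j + 1) ^ 2
  + (max (cOne μ ε₀ (j + 1)) (1 / ε₀)) ^ 2 * ∑ k ∈ Finset.Icc 2 j, (classCard μ k : ℝ)
  + 2 * (∑ k ∈ Finset.Icc 1 j, (classCard μ k : ℝ)) / (gap μ (i + 1) - gap μ j) ^ 2
  + ∑ k ∈ Finset.Icc (j + 1) (numClasses μ), (classCard μ k : ℝ)
      * (max (max (cOne μ ε₀ (j + 1)) (1 / ε₀)) (√2 / gap μ k)) ^ 2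

/-- `H_i(μ, ε₀) = min_{j ∈ [i]} max {H̄_{i,j}(μ, ε₀), H̃_{i,j}(μ, ε₀)}` for `1 ≤ i < C_μ`. -/
def complexity {K : ℕ} (μ : Fin K → ℝ) (ε₀ : ℝ) (i : ℕ) : ℝ :=
  ⨅ j : Finset.Icc 1 i, max (hBar μ ε₀ i j) (hTilde μ ε₀ i j)

/-- `p(x) = x - log x`. -/
def pFun (x : ℝ) : ℝ := x - Real.log x

/-! ### The algorithm, along one trajectory

Rounds are numbered `1, 2, 3, …`. `I t` is the arm pulled and `X t` the reward seen in round `t`;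
`B t` and `C t` are the leader and the challenger, defined in the rounds `t > K`. -/

/-- `N_{n,i}`: number of pulls of arm `i` before time `n`. -/
def pulls {K : ℕ} (I : ℕ → Fin K) (n : ℕ) (i : Fin K) : ℕ :=
  ((Finset.Ico 1 n).filter fun t => I t = i).card

/-- `μ_{n,i}`: empirical mean of arm `i` before time `n`. -/
def empMean {K : ℕ} (I : ℕ → Fin K) (X : ℕ → ℝ) (n : ℕ) (i : Fin K) : ℝ :=
  (∑ t ∈ (Finset.Ico 1 n).filter (fun t => I t = i), X t) / pulls I n i

/-- `T_n(i,j)`: number of rounds before time `n` with leader `i` and challenger `j`. -/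
def pairCount {K : ℕ} (B C : ℕ → Fin K) (n : ℕ) (i j : Fin K) : ℕ :=
  ((Finset.Ico (K + 1) n).filter fun t => B t = i ∧ C t = j).card

/-- Number of rounds before time `n` with leader `i` and challenger `j` in which the challenger
`j` was pulled, written `N^i_{n,j}`. -/
def challengerPulls {K : ℕ} (I B C : ℕ → Fin K) (n : ℕ) (i j : Fin K) : ℕ :=
  ((Finset.Ico (K + 1) n).filter fun t => B t = i ∧ C t = j ∧ I t = j).card

/-- Empirical transportation cost with slack `ε₀` at time `n`, of leader `i` and challenger `j`. -/
def transportCost {K : ℕ} (I : ℕ → Fin K) (X : ℕ → ℝ) (ε₀ : ℝ) (n : ℕ) (i j : Fin K) : ℝ :=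
  (empMean I X n i - empMean I X n j + ε₀) / √(1 / (pulls I n i : ℝ) + 1 / (pulls I n j : ℝ))

/-- The trajectory follows the EB-TC algorithm with slack `ε₀` and fixed proportion `β`, for some
way of breaking ties. The arm recommended at time `n > K` is the leader `B n`. -/
structure IsRun {K : ℕ} (ε₀ β : ℝ) (I : ℕ → Fin K) (X : ℕ → ℝ) (B C : ℕ → Fin K) : Prop where
  /-- every arm is pulled exactly once during the first `K` rounds -/
  init : ∀ i, pulls I (K + 1) i = 1
  /-- the leader has the largest empirical mean -/
  leader : ∀ n, K < n → ∀ i, empMean I X n i ≤ empMean I X n (B n)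
  /-- the challenger differs from the leader -/
  challenger_ne : ∀ n, K < n → C n ≠ B n
  /-- the challenger minimizes the transportation cost -/
  challenger : ∀ n, K < n → ∀ i, i ≠ B n →
    transportCost I X ε₀ n (B n) (C n) ≤ transportCost I X ε₀ n (B n) i
  /-- tracking, separately for each pair of a leader and a challenger -/
  tracking : ∀ n, K < n → I n =
    if (challengerPulls I B C n (B n) (C n) : ℝ) ≤ (1 - β) * pairCount B C (n + 1) (B n) (C n)
    then C n else B n

/-! ### Interaction with the bandit -/

/-- `I`, `X`, `B`, `C` are the random pulled arms, rewards, leaders and challengers of EB-TC with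
slack `ε₀` and fixed proportion `β` on the bandit `ν`. The σ-algebra `𝓕 t` is the information
available at the end of round `t`; it may hold, besides the past arms and rewards, any randomness
used to break ties. -/
structure IsEBTC {K : ℕ} {Ω : Type*} [mΩ : MeasurableSpace Ω] (P : Measure Ω)
    (ν : Fin K → Measure ℝ) (ε₀ β : ℝ) (𝓕 : Filtration ℕ mΩ)
    (I : ℕ → Ω → Fin K) (X : ℕ → Ω → ℝ) (B C : ℕ → Ω → Fin K) : Prop where
  /-- choices of a round depend on the information available before it -/
  measurable_arm : ∀ t, Measurable[𝓕 t] (I (t + 1))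
  measurable_leader : ∀ t, Measurable[𝓕 t] (B (t + 1))
  measurable_challenger : ∀ t, Measurable[𝓕 t] (C (t + 1))
  /-- the reward is seen at the end of the round -/
  measurable_reward : ∀ t, Measurable[𝓕 (t + 1)] (X (t + 1))
  /-- given the past and the choice of the arm, the reward is drawn from that arm -/
  reward_law : ∀ t, ∀ s : Set ℝ, MeasurableSet s →
    P⟦X (t + 1) ⁻¹' s | 𝓕 t⟧ =ᵐ[P] fun ω => (ν (I (t + 1) ω)).real s
  /-- almost every trajectory follows the algorithm -/
  run : ∀ᵐ ω ∂P, IsRun ε₀ β (fun t => I t ω) (fun t => X t ω) (fun t => B t ω) (fun t => C t ω)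

end EBTC

end

/-!
Suppose that all empirical means are accurate at level `x` up to time `n`, while the arm recommended
at time `n` has gap at least `Δ_{i+1}`, and let `1 ≤ j ≤ i`. If the recommended arm is itself poorly
explored, it is cheap to confuse with the leader in every earlier round; if it is well explored, all
arms with gap at most `Δ_j` are poorly explored, since they would be recommended instead. In both
cases every round has an undersampled leader or challenger, one pulled at most `4 x c²` times for a
constant `c` of the arm. The tracking rule gives both arms of a pair their share of its rounds, so a
fixed fraction of all rounds, up to `O(K²)` of them, pulls an undersampled arm. Summing `c²` over
the arms gives at most `H̄_{i,j}` in the first case and at most `H̃_{i,j}` in the second, so that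
`n` is at most of order `x H_i + K²`.

For a pair of arms with pull counts known up to a factor `e`, the exponential supermartingale of the
rewards, mixed over independent centred Gaussian tilts, exceeds a multiple of `e^x / x` as soon as
the means of the pair are inaccurate. Ville's inequality and a union bound over the pairs of arms
and the `(2 + log n)²` pairs of exponential scales bound the probability of inaccuracy by
`K² e² (2 + log n)² x e^{-x}`. The regret is the sum of the increments `Δ_{i+1} - Δ_i` over the
events that it is at least `Δ_{i+1}`.
-/

namespace EBTC

section Gaps

variable {K : ℕ} (μ : Fin K → ℝ)

theorem card_gapValues : (gapValues μ).card = numClasses μ := by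
  have himage : gapValues μ = (Finset.univ.image μ).image (bestMean μ - ·) := by
    rw [gapValues, Finset.image_image]
    rfl
  rw [himage, Finset.card_image_of_injective _ (sub_right_injective (b := bestMean μ)), numClasses]

theorem gap_eq_orderEmbOfFin {i : ℕ} (hi : i ∈ Set.Icc 1 (numClasses μ)) :
    gap μ i = (gapValues μ).orderEmbOfFin (card_gapValues μ)
      ⟨i - 1, Nat.sub_one_lt_of_le hi.1 hi.2⟩ := by
  rw [gap, Finset.orderEmbOfFin_apply, List.getD_eq_getElem]
  rfl

theorem gap_strictMonoOn : StrictMonoOn (gap μ) (Set.Icc 1 (numClasses μ)) := by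
  intro i hi j hj hij
  rw [gap_eq_orderEmbOfFin μ hi, gap_eq_orderEmbOfFin μ hj]
  exact (OrderEmbedding.lt_iff_lt _).2 (Fin.mk_lt_mk.2 (Nat.sub_lt_sub_right hi.1 hij))

theorem gap_mem_gapValues {i : ℕ} (hi : i ∈ Set.Icc 1 (numClasses μ)) :
    gap μ i ∈ gapValues μ := by
  rw [gap_eq_orderEmbOfFin μ hi]
  exact Finset.orderEmbOfFin_mem _ _ _

theorem exists_eq_gap (k : Fin K) :
    ∃ m ∈ Finset.Icc 1 (numClasses μ), bestMean μ - μ k = gap μ m := by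
  have hrange : bestMean μ - μ k ∈
      Set.range ((gapValues μ).orderEmbOfFin (card_gapValues μ)) := by
    rw [Finset.range_orderEmbOfFin]
    exact Finset.mem_image_of_mem _ (Finset.mem_univ k)
  obtain ⟨a, ha⟩ := hrange
  refine ⟨a + 1, Finset.mem_Icc.2 ⟨by lia, a.2⟩, ?_⟩
  rw [gap_eq_orderEmbOfFin μ ⟨by lia, a.2⟩, ← ha]
  rfl

theorem gap_add_one_le_of_lt {j : ℕ} (hj : j ∈ Set.Icc 1 (numClasses μ)) {k : Fin K}
    (h : gap μ j < bestMean μ - μ k) : gap μ (j + 1) ≤ bestMean μ - μ k := by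
  obtain ⟨m, hm, hgap⟩ := exists_eq_gap μ k
  have hm' := Finset.mem_Icc.1 hm
  rw [hgap] at h ⊢
  have hjm : j < m := ((gap_strictMonoOn μ).lt_iff_lt hj hm').1 h
  exact (gap_strictMonoOn μ).monotoneOn ⟨by lia, by lia⟩ hm' hjm

theorem le_bestMean (k : Fin K) : μ k ≤ bestMean μ :=
  le_ciSup (Set.finite_range μ).bddAbove k

theorem sum_comp_gap (f : ℝ → ℝ) :
    ∑ k, f (bestMean μ - μ k) = ∑ m ∈ Finset.Icc 1 (numClasses μ), classCard μ m * f (gap μ m) := by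
  choose c hc hgap using exists_eq_gap μ
  rw [← Finset.sum_fiberwise_of_maps_to (g := c) fun k _ => hc k]
  refine Finset.sum_congr rfl fun m hm => ?_
  have hfilter : Finset.univ.filter (c · = m)
      = Finset.univ.filter (bestMean μ - μ · = gap μ m) := by
    ext k
    rw [Finset.mem_filter_univ, Finset.mem_filter_univ, hgap k,
      (gap_strictMonoOn μ).injOn.eq_iff (Finset.mem_Icc.1 (hc k)) (Finset.mem_Icc.1 hm)]
  rw [hfilter, classCard, ← nsmul_eq_mul]
  exact Finset.sum_eq_card_nsmul fun k hk => congrArg f (Finset.mem_filter.1 hk).2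

theorem sum_classCard : ∑ m ∈ Finset.Icc 1 (numClasses μ), (classCard μ m : ℝ) = K := by
  simpa using (sum_comp_gap μ fun _ => 1).symm

theorem sum_Icc_add_sum_Icc (f : ℕ → ℝ) {a b c : ℕ} (hab : a ≤ b + 1) (hbc : b ≤ c) :
    ∑ k ∈ Finset.Icc a b, f k + ∑ k ∈ Finset.Icc (b + 1) c, f k = ∑ k ∈ Finset.Icc a c, f k := by
  simp only [← Finset.Ico_add_one_right_eq_Icc]
  exact Finset.sum_Ico_consecutive f hab (by lia)

theorem sum_ite_le_gap {j : ℕ} (hj : j ∈ Finset.Icc 1 (numClasses μ)) (a b : ℝ) :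
    ∑ k, (if bestMean μ - μ k ≤ gap μ j then a else b)
      = (∑ m ∈ Finset.Icc 1 j, (classCard μ m : ℝ)) * a
        + (∑ m ∈ Finset.Icc (j + 1) (numClasses μ), (classCard μ m : ℝ)) * b := by
  have hj' := Finset.mem_Icc.1 hj
  have hiff : ∀ m ∈ Finset.Icc 1 (numClasses μ), gap μ m ≤ gap μ j ↔ m ≤ j := fun m hm =>
    (gap_strictMonoOn μ).le_iff_le (Finset.mem_Icc.1 hm) hj'
  rw [sum_comp_gap μ fun x => if x ≤ gap μ j then a else b,
    ← sum_Icc_add_sum_Icc _ (Nat.le_add_left 1 j) hj'.2, Finset.sum_mul, Finset.sum_mul]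
  congr 1 <;> refine Finset.sum_congr rfl fun m hm => ?_ <;> rw [Finset.mem_Icc] at hm
  · rw [if_pos ((hiff m (Finset.mem_Icc.2 (by lia))).2 hm.2)]
  · rw [if_neg (mt (hiff m (Finset.mem_Icc.2 (by lia))).1 (by lia))]

variable [NeZero K]

theorem exists_eq_bestMean : ∃ k, μ k = bestMean μ :=
  exists_eq_ciSup_of_finite

theorem numClasses_pos : 0 < numClasses μ :=
  Finset.card_pos.2 (Finset.univ_nonempty.image μ)

theorem gap_one : gap μ 1 = 0 := by
  obtain ⟨best, hbest⟩ := exists_eq_bestMean μ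
  obtain ⟨m, hm, hgap⟩ := exists_eq_gap μ best
  have hm' := Finset.mem_Icc.1 hm
  have hone : 1 ∈ Set.Icc 1 (numClasses μ) := ⟨le_rfl, numClasses_pos μ⟩
  have hle : gap μ 1 ≤ gap μ m := (gap_strictMonoOn μ).monotoneOn hone hm' hm'.1
  obtain ⟨k, -, hk⟩ := Finset.mem_image.1 (gap_mem_gapValues μ hone)
  linarith [le_bestMean μ k]

theorem gap_nonneg {i : ℕ} (hi : i ∈ Set.Icc 1 (numClasses μ)) : 0 ≤ gap μ i := by
  rw [← gap_one μ]
  exact (gap_strictMonoOn μ).monotoneOn ⟨le_rfl, numClasses_pos μ⟩ hi hi.1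

theorem gap_pos {i : ℕ} (hi : i ∈ Set.Icc 2 (numClasses μ)) : 0 < gap μ i := by
  rw [← gap_one μ]
  exact gap_strictMonoOn μ ⟨le_rfl, numClasses_pos μ⟩ ⟨one_le_two.trans hi.1, hi.2⟩ hi.1

theorem numBest_eq_classCard_one : numBest μ = classCard μ 1 := by
  simp only [numBest, classCard, gap_one, sub_eq_zero, eq_comm]

theorem numBest_add_sum_classCard {j : ℕ} (hj : 1 ≤ j) :
    numBest μ + ∑ k ∈ Finset.Icc 2 j, (classCard μ k : ℝ)
      = ∑ k ∈ Finset.Icc 1 j, (classCard μ k : ℝ) := by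
  rw [← sum_Icc_add_sum_Icc _ (Nat.le_add_left 1 1) hj, numBest_eq_classCard_one,
    Finset.Icc_self, Finset.sum_singleton]

theorem regret_eq_sum_gap_sub (k : Fin K) :
    bestMean μ - μ k = ∑ i ∈ Finset.Icc 1 (numClasses μ - 1),
      (gap μ (i + 1) - gap μ i) * (if gap μ (i + 1) ≤ bestMean μ - μ k then 1 else 0) := by
  obtain ⟨m, hm, hgap⟩ := exists_eq_gap μ k
  have hm' := Finset.mem_Icc.1 hm
  have hiff : ∀ i ∈ Finset.Icc 1 (numClasses μ - 1),
      gap μ (i + 1) ≤ bestMean μ - μ k ↔ i < m := fun i hi => by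
    have hi' := Finset.mem_Icc.1 hi
    rw [hgap, (gap_strictMonoOn μ).le_iff_le ⟨by lia, by lia⟩ hm', Nat.add_one_le_iff]
  calc bestMean μ - μ k = gap μ m - gap μ 1 := by rw [hgap, gap_one, sub_zero]
    _ = ∑ i ∈ Finset.Ico 1 m, (gap μ (i + 1) - gap μ i) := (Finset.sum_Ico_sub _ hm'.1).symm
    _ = ∑ i ∈ (Finset.Icc 1 (numClasses μ - 1)).filter (· < m), (gap μ (i + 1) - gap μ i) := by
        congr 1
        ext i
        simp only [Finset.mem_filter, Finset.mem_Icc, Finset.mem_Ico]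
        lia
    _ = _ := by
        rw [Finset.sum_filter]
        refine Finset.sum_congr rfl fun i hi => ?_
        simp only [hiff i hi, mul_ite, mul_one, mul_zero]

end Gaps

section Complexities

variable {K : ℕ} (μ : Fin K → ℝ) {ε₀ : ℝ} {i j : ℕ}

theorem gap_sub_gap_pos (hj : j ∈ Finset.Icc 1 i) (hi : i < numClasses μ) :
    0 < gap μ (i + 1) - gap μ j := by
  have hj' := Finset.mem_Icc.1 hj
  exact sub_pos.2 (gap_strictMonoOn μ ⟨hj'.1, by lia⟩ ⟨by lia, hi⟩ (by lia))

theorem cOne_le_two_div_gap (hε : 0 < ε₀) : cOne μ ε₀ i ≤ 2 / gap μ i :=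
  sub_le_self _ (one_div_pos.2 hε).le

theorem one_div_gap_le_max_cOne : 1 / gap μ i ≤ max (cOne μ ε₀ i) (1 / ε₀) := by
  have hcOne := le_max_left (cOne μ ε₀ i) (1 / ε₀)
  have hε := le_max_right (cOne μ ε₀ i) (1 / ε₀)
  have hc : cOne μ ε₀ i = 2 * (1 / gap μ i) - 1 / ε₀ := by rw [cOne]; ring
  linarith

theorem le_hTilde (hε : 0 < ε₀) :
    (∑ k ∈ Finset.Icc 1 j, (classCard μ k : ℝ)) * (1 / (gap μ (i + 1) - gap μ j)) ^ 2
      + (∑ k ∈ Finset.Icc (j + 1) (numClasses μ), (classCard μ k : ℝ))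
        * max (cOne μ ε₀ (j + 1)) (1 / ε₀) ^ 2 ≤ hTilde μ ε₀ i j := by
  have hmax : 0 ≤ max (cOne μ ε₀ (j + 1)) (1 / ε₀) :=
    (one_div_pos.2 hε).le.trans (le_max_right _ _)
  rw [hTilde, Finset.sum_mul _ _ (max _ _ ^ 2)]
  refine add_le_add (le_add_of_nonneg_of_le (by positivity) ?_)
    (Finset.sum_le_sum fun k _ => ?_)
  · rw [one_div_pow, mul_one_div, mul_div_assoc]
    exact le_mul_of_one_le_left (by positivity) one_le_two
  · exact mul_le_mul_of_nonneg_left (pow_le_pow_left₀ hmax (le_max_left _ _) 2)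
      (Nat.cast_nonneg _)

theorem complexity_le (hj : j ∈ Finset.Icc 1 i) :
    complexity μ ε₀ i ≤ max (hBar μ ε₀ i j) (hTilde μ ε₀ i j) :=
  ciInf_le (f := fun j : Finset.Icc 1 i => max (hBar μ ε₀ i j) (hTilde μ ε₀ i j))
    (Set.finite_range _).bddBelow ⟨j, hj⟩

theorem exists_complexity_eq (hi : 1 ≤ i) :
    ∃ j ∈ Finset.Icc 1 i, max (hBar μ ε₀ i j) (hTilde μ ε₀ i j) = complexity μ ε₀ i := by
  have : Nonempty (Finset.Icc 1 i) := ⟨⟨1, Finset.left_mem_Icc.2 hi⟩⟩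
  obtain ⟨j, hj⟩ := exists_eq_ciInf_of_finite
    (f := fun j : Finset.Icc 1 i => max (hBar μ ε₀ i j) (hTilde μ ε₀ i j))
  exact ⟨j, j.2, hj⟩

variable [NeZero K]

theorem gap_nonneg_of_mem_Icc (hj : j ∈ Finset.Icc 1 i) (hi : i < numClasses μ) :
    0 ≤ gap μ j := by
  have hj' := Finset.mem_Icc.1 hj
  exact gap_nonneg μ ⟨hj'.1, by lia⟩

theorem gap_add_one_pos (hj : j ∈ Finset.Icc 1 i) (hi : i < numClasses μ) :
    0 < gap μ (j + 1) := by
  have hj' := Finset.mem_Icc.1 hj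
  exact gap_pos μ ⟨by lia, by lia⟩

theorem one_div_le_cTwo (hε : 0 < ε₀) (hj : j ∈ Finset.Icc 1 i) (hi : i < numClasses μ) :
    1 / ε₀ ≤ cTwo μ ε₀ (i + 1) j := by
  have hd := gap_sub_gap_pos μ hj hi
  have hg := gap_nonneg_of_mem_Icc μ hj hi
  calc 1 / ε₀ ≤ 3 / ε₀ := by gcongr; norm_num
    _ ≤ cTwo μ ε₀ (i + 1) j := le_add_of_nonneg_left (by positivity)

theorem two_div_gap_sub_le_cTwo (hε : 0 < ε₀) (hj : j ∈ Finset.Icc 1 i)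
    (hi : i < numClasses μ) : 2 / (gap μ (i + 1) - gap μ j) ≤ cTwo μ ε₀ (i + 1) j := by
  have hd := gap_sub_gap_pos μ hj hi
  have hg := gap_nonneg_of_mem_Icc μ hj hi
  calc 2 / (gap μ (i + 1) - gap μ j)
      = 2 * ((0 + 1) / (gap μ (i + 1) - gap μ j)) + 0 := by ring
    _ ≤ cTwo μ ε₀ (i + 1) j := by rw [cTwo]; gcongr <;> positivity

theorem two_div_gap_le_cTwo (hε : 0 < ε₀) (hj : j ∈ Finset.Icc 1 i) (hi : i < numClasses μ) :
    2 / gap μ (i + 1) ≤ cTwo μ ε₀ (i + 1) j := by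
  have hd := gap_sub_gap_pos μ hj hi
  have hg := gap_nonneg_of_mem_Icc μ hj hi
  refine le_trans ?_ (two_div_gap_sub_le_cTwo μ hε hj hi)
  gcongr
  exact sub_le_self _ hg

theorem cTwo_pos (hε : 0 < ε₀) (hj : j ∈ Finset.Icc 1 i) (hi : i < numClasses μ) :
    0 < cTwo μ ε₀ (i + 1) j :=
  (one_div_pos.2 hε).trans_le (one_div_le_cTwo μ hε hj hi)

theorem sqrt_two_div_gap_le {k : ℕ} (hk : k ∈ Finset.Icc (j + 1) (numClasses μ)) (hj : 1 ≤ j) :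
    √2 / gap μ k ≤ 2 / gap μ (j + 1) := by
  have hk' := Finset.mem_Icc.1 hk
  have hpos : 0 < gap μ (j + 1) := gap_pos μ ⟨by lia, by lia⟩
  have hle : gap μ (j + 1) ≤ gap μ k :=
    (gap_strictMonoOn μ).monotoneOn ⟨by lia, by lia⟩ ⟨by lia, hk'.2⟩ hk'.1
  have hsqrt : √2 ≤ 2 := Real.sqrt_le_iff.2 (by norm_num)
  gcongr

theorem numBest_add_sum_classCard_add (hj : j ∈ Finset.Icc 1 i) (hi : i < numClasses μ) :
    (numBest μ : ℝ) + (∑ k ∈ Finset.Icc 2 j, (classCard μ k : ℝ)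
        + ∑ k ∈ Finset.Icc (i + 1) (numClasses μ), (classCard μ k : ℝ))
      + ∑ k ∈ Finset.Icc (j + 1) i, (classCard μ k : ℝ) = K := by
  have hj' := Finset.mem_Icc.1 hj
  rw [← sum_classCard μ, ← sum_Icc_add_sum_Icc _ (Nat.le_add_left 1 i) hi.le,
    ← sum_Icc_add_sum_Icc _ (Nat.le_add_left 1 j) hj'.2, ← numBest_add_sum_classCard μ hj'.1]
  ring

theorem le_hBar (hε : 0 < ε₀) (hj : j ∈ Finset.Icc 1 i) (hi : i < numClasses μ) :
    K * cTwo μ ε₀ (i + 1) j ^ 2 ≤ hBar μ ε₀ i j := by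
  have hc := (cTwo_pos μ hε hj hi).le
  rw [hBar, ← numBest_add_sum_classCard_add μ hj hi, add_mul, add_mul, Finset.sum_mul,
    mul_comm (_ + _) (cTwo _ _ _ _ ^ 2)]
  gcongr
  · exact le_max_right _ _
  · exact le_max_right _ _
  · exact (le_max_right _ _).trans (le_max_left _ _)

theorem hBar_le (hε : 0 < ε₀) (hj : j ∈ Finset.Icc 1 i) (hi : i < numClasses μ) {M : ℝ}
    (hgap : 2 / gap μ (j + 1) ≤ M) (hcTwo : cTwo μ ε₀ (i + 1) j ≤ M) :
    hBar μ ε₀ i j ≤ K * M ^ 2 := by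
  have hj' := Finset.mem_Icc.1 hj
  have hc := (cTwo_pos μ hε hj hi).le
  have hmax : max (cOne μ ε₀ (j + 1)) (cTwo μ ε₀ (i + 1) j) ≤ M :=
    max_le ((cOne_le_two_div_gap μ hε).trans hgap) hcTwo
  have hsqrt : ∀ k ∈ Finset.Icc (j + 1) (numClasses μ), √2 / gap μ k ≤ M := fun k hk =>
    (sqrt_two_div_gap_le μ hk hj'.1).trans hgap
  rw [hBar, ← numBest_add_sum_classCard_add μ hj hi, add_mul, add_mul, Finset.sum_mul,
    mul_comm (_ + _) (M ^ 2)]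
  refine add_le_add (add_le_add ?_ ?_) (Finset.sum_le_sum fun k hk => ?_)
  · gcongr
    exact max_le (hsqrt _ (Finset.mem_Icc.2 (by lia))) hcTwo
  · gcongr
  · have hk' := Finset.mem_Icc.1 hk
    gcongr
    exact max_le hmax (hsqrt k (Finset.mem_Icc.2 (by lia)))

theorem hTilde_le (hε : 0 < ε₀) (hj : j ∈ Finset.Icc 1 i) (hi : i < numClasses μ) {M : ℝ}
    (hgap : 2 / gap μ (j + 1) ≤ M) (hcTwo : cTwo μ ε₀ (i + 1) j ≤ M) :
    hTilde μ ε₀ i j ≤ (K + 1 / 2 * ∑ k ∈ Finset.Icc 2 j, (classCard μ k : ℝ)) * M ^ 2 := by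
  have hj' := Finset.mem_Icc.1 hj
  have hg := gap_add_one_pos μ hj hi
  have hd := gap_sub_gap_pos μ hj hi
  have hmax : max (cOne μ ε₀ (j + 1)) (1 / ε₀) ≤ M :=
    max_le ((cOne_le_two_div_gap μ hε).trans hgap) ((one_div_le_cTwo μ hε hj hi).trans hcTwo)
  have hsub := (two_div_gap_sub_le_cTwo μ hε hj hi).trans hcTwo
  have hbest : 2 * (numBest μ : ℝ) / gap μ (j + 1) ^ 2 ≤ 1 / 2 * numBest μ * M ^ 2 :=
    calc _ = 1 / 2 * numBest μ * (2 / gap μ (j + 1)) ^ 2 := by ring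
      _ ≤ _ := by gcongr
  have hsmall : max (cOne μ ε₀ (j + 1)) (1 / ε₀) ^ 2 * ∑ k ∈ Finset.Icc 2 j, (classCard μ k : ℝ)
      ≤ M ^ 2 * ∑ k ∈ Finset.Icc 2 j, (classCard μ k : ℝ) := by gcongr
  have hnear : 2 * (∑ k ∈ Finset.Icc 1 j, (classCard μ k : ℝ)) / (gap μ (i + 1) - gap μ j) ^ 2
      ≤ 1 / 2 * (∑ k ∈ Finset.Icc 1 j, (classCard μ k : ℝ)) * M ^ 2 :=
    calc _ = 1 / 2 * (∑ k ∈ Finset.Icc 1 j, (classCard μ k : ℝ))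
          * (2 / (gap μ (i + 1) - gap μ j)) ^ 2 := by rw [div_pow]; ring
      _ ≤ _ := by gcongr
  have hfar : ∑ k ∈ Finset.Icc (j + 1) (numClasses μ), (classCard μ k : ℝ)
        * (max (max (cOne μ ε₀ (j + 1)) (1 / ε₀)) (√2 / gap μ k)) ^ 2
      ≤ (∑ k ∈ Finset.Icc (j + 1) (numClasses μ), (classCard μ k : ℝ)) * M ^ 2 := by
    rw [Finset.sum_mul]
    refine Finset.sum_le_sum fun k hk => ?_
    gcongr
    exact max_le hmax ((sqrt_two_div_gap_le μ hk hj'.1).trans hgap)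
  have hsum := sum_Icc_add_sum_Icc (fun k => (classCard μ k : ℝ)) (Nat.le_add_left 1 j)
    (by lia : j ≤ numClasses μ)
  rw [← numBest_add_sum_classCard μ hj'.1] at hnear hsum
  rw [hTilde, ← sum_classCard μ, ← numBest_add_sum_classCard μ hj'.1, ← hsum]
  linarith

theorem complexity_one (hε : 0 < ε₀) (hC : 2 ≤ numClasses μ) :
    complexity μ ε₀ 1 = K * (2 / gap μ 2 + 3 / ε₀) ^ 2 := by
  have hone : 1 ∈ Finset.Icc 1 1 := Finset.mem_Icc.2 ⟨le_rfl, le_rfl⟩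
  have hc : cTwo μ ε₀ 2 1 = 2 / gap μ 2 + 3 / ε₀ := by
    rw [cTwo, gap_one]
    ring
  have hgap : 2 / gap μ 2 ≤ cTwo μ ε₀ 2 1 := two_div_gap_le_cTwo μ hε hone hC
  have hle : max (hBar μ ε₀ 1 1) (hTilde μ ε₀ 1 1) ≤ K * cTwo μ ε₀ 2 1 ^ 2 :=
    max_le (hBar_le μ hε hone hC hgap le_rfl)
      (by simpa using hTilde_le μ hε hone hC hgap le_rfl)
  obtain ⟨j, hj, hcomplexity⟩ := exists_complexity_eq μ (ε₀ := ε₀) le_rfl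
  obtain rfl : j = 1 := by simpa using hj
  rw [← hcomplexity, ← hc]
  exact le_antisymm hle ((le_hBar μ hε hone hC).trans (le_max_left _ _))

theorem le_complexity (hε : 0 < ε₀) (h_one : 1 ≤ i) (hi : i < numClasses μ) :
    2 * K / gap μ (i + 1) ^ 2 ≤ complexity μ ε₀ i := by
  obtain ⟨j, hj, hcomplexity⟩ := exists_complexity_eq μ (ε₀ := ε₀) h_one
  have hg : 0 < gap μ (i + 1) := gap_pos μ ⟨by lia, hi⟩
  calc 2 * K / gap μ (i + 1) ^ 2 ≤ 4 * K / gap μ (i + 1) ^ 2 := by gcongr; norm_num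
    _ = K * (2 / gap μ (i + 1)) ^ 2 := by ring
    _ ≤ K * cTwo μ ε₀ (i + 1) j ^ 2 := by
        gcongr
        exact two_div_gap_le_cTwo μ hε hj hi
    _ ≤ max (hBar μ ε₀ i j) (hTilde μ ε₀ i j) := (le_hBar μ hε hj hi).trans (le_max_left _ _)
    _ = complexity μ ε₀ i := hcomplexity

theorem complexity_pos (hε : 0 < ε₀) (h_one : 1 ≤ i) (hi : i < numClasses μ) :
    0 < complexity μ ε₀ i := by
  have hg : 0 < gap μ (i + 1) := gap_pos μ ⟨by lia, hi⟩
  have hK : (0 : ℝ) < K := Nat.cast_pos.2 (NeZero.pos K)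
  exact (by positivity : 0 < 2 * K / gap μ (i + 1) ^ 2).trans_le (le_complexity μ hε h_one hi)

theorem complexity_le_mul (hε : 0 < ε₀) (hj : j ∈ Finset.Icc 1 i) (hi : i < numClasses μ) :
    complexity μ ε₀ i
      ≤ 3 / 2 * (K * max (2 / gap μ (j + 1)) (cTwo μ ε₀ (i + 1) j) ^ 2) := by
  have hj' := Finset.mem_Icc.1 hj
  set M := max (2 / gap μ (j + 1)) (cTwo μ ε₀ (i + 1) j)
  have hsum : ∑ k ∈ Finset.Icc 2 j, (classCard μ k : ℝ) ≤ K := by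
    rw [← sum_classCard μ]
    exact Finset.sum_le_sum_of_subset_of_nonneg (Finset.Icc_subset_Icc one_le_two (by lia))
      fun _ _ _ => Nat.cast_nonneg _
  refine (complexity_le μ hj).trans (max_le ?_ ?_)
  · calc hBar μ ε₀ i j ≤ K * M ^ 2 := hBar_le μ hε hj hi (le_max_left _ _) (le_max_right _ _)
      _ ≤ 3 / 2 * (K * M ^ 2) := le_mul_of_one_le_left (by positivity) (by norm_num)
  · calc hTilde μ ε₀ i j ≤ (K + 1 / 2 * ∑ k ∈ Finset.Icc 2 j, (classCard μ k : ℝ)) * M ^ 2 :=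
          hTilde_le μ hε hj hi (le_max_left _ _) (le_max_right _ _)
      _ ≤ (K + 1 / 2 * K) * M ^ 2 := by gcongr
      _ = 3 / 2 * (K * M ^ 2) := by ring

end Complexities

section Counting

variable {K : ℕ} {ε₀ β : ℝ} {I : ℕ → Fin K} {X : ℕ → ℝ} {B C : ℕ → Fin K}

theorem card_filter_Ico_succ (p : ℕ → Prop) [DecidablePred p] {a n : ℕ} (h : a ≤ n) :
    ((Finset.Ico a (n + 1)).filter p).card
      = ((Finset.Ico a n).filter p).card + if p n then 1 else 0 := by
  simp only [Finset.card_filter]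
  exact Finset.sum_Ico_succ_top h _

theorem pulls_mono (I : ℕ → Fin K) (i : Fin K) : Monotone fun n => pulls I n i :=
  fun _ _ h => Finset.card_le_card
    (Finset.filter_subset_filter _ (Finset.Ico_subset_Ico_right h))

theorem pulls_lt_pulls {t s : ℕ} (ht : 1 ≤ t) (hts : t < s) :
    pulls I t (I t) < pulls I s (I t) :=
  calc pulls I t (I t) < pulls I (t + 1) (I t) := by
        rw [pulls, pulls, card_filter_Ico_succ _ ht, if_pos rfl]
        exact Nat.lt_succ_self _
    _ ≤ pulls I s (I t) := pulls_mono I (I t) hts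

theorem pulls_le (I : ℕ → Fin K) (n : ℕ) (i : Fin K) : pulls I n i ≤ n - 1 :=
  (Finset.card_filter_le _ _).trans (Nat.card_Ico 1 n).le

theorem IsRun.one_le_pulls (h : IsRun ε₀ β I X B C) {t : ℕ} (ht : K < t) (i : Fin K) :
    1 ≤ pulls I t i :=
  (h.init i).ge.trans (pulls_mono I i ht)

theorem IsRun.challengerPulls_mem_Icc (h : IsRun ε₀ β I X B C) (hβ : β ∈ Set.Icc 0 1)
    {i j : Fin K} (hij : i ≠ j) (n : ℕ) : (challengerPulls I B C n i j : ℝ) ∈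
      Set.Icc ((1 - β) * pairCount B C n i j) ((1 - β) * pairCount B C n i j + 1) := by
  obtain ⟨hβ_nonneg, hβ_le_one⟩ := hβ
  induction n with
  | zero => simp [pairCount, challengerPulls]
  | succ n ih =>
    obtain ⟨hlower, hupper⟩ := ih
    rcases lt_or_ge n (K + 1) with hn | hn
    · simp [pairCount, challengerPulls, Finset.Ico_eq_empty_of_le (Nat.succ_le_of_lt hn)]
    have hround := h.tracking n hn
    have hpair : pairCount B C (n + 1) i j = pairCount B C n i j + _ :=
      card_filter_Ico_succ (fun t => B t = i ∧ C t = j) hn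
    have hpulls : challengerPulls I B C (n + 1) i j = challengerPulls I B C n i j + _ :=
      card_filter_Ico_succ (fun t => B t = i ∧ C t = j ∧ I t = j) hn
    by_cases hBC : B n = i ∧ C n = j
    · rw [if_pos hBC] at hpair
      rw [hBC.1, hBC.2, hpair] at hround
      rw [hpair, hpulls]
      push_cast at hround ⊢
      split_ifs at hround with hle
      · rw [if_pos ⟨hBC.1, hBC.2, hround⟩]
        constructor <;> linarith
      · rw [if_neg fun hpull => hij (hround.symm.trans hpull.2.2)]
        constructor <;> linarith
    · rw [hpair, hpulls, if_neg hBC, if_neg fun hpull => hBC ⟨hpull.1, hpull.2.1⟩]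
      exact ⟨hlower, hupper⟩

theorem IsRun.card_leader_pulls_add_challengerPulls (h : IsRun ε₀ β I X B C) {i j : Fin K}
    (hij : i ≠ j) (n : ℕ) :
    ((Finset.Ico (K + 1) n).filter fun t => B t = i ∧ C t = j ∧ I t = i).card
      + challengerPulls I B C n i j = pairCount B C n i j := by
  rw [challengerPulls, pairCount, ← Finset.card_union_of_disjoint]
  · congr 1
    ext t
    simp only [Finset.mem_union, Finset.mem_filter, Finset.mem_Ico]
    refine ⟨by tauto, fun ⟨ht, hB, hC⟩ => ?_⟩
    have hpull : I t = j ∨ I t = i := by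
      rw [h.tracking t ht.1, hB, hC]
      exact ite_eq_or_eq _ _ _
    tauto
  · rw [Finset.disjoint_filter]
    exact fun t _ hleader hchallenger => hij (hleader.2.2.symm.trans hchallenger.2.2)

theorem IsRun.min_mul_pairCount_le (h : IsRun ε₀ β I X B C) (hβ : β ∈ Set.Icc 0 1)
    {i j a : Fin K} (hij : i ≠ j) (ha : a = i ∨ a = j) (n : ℕ) :
    min β (1 - β) * pairCount B C n i j ≤
      ((Finset.Ico (K + 1) n).filter fun t => B t = i ∧ C t = j ∧ I t = a).card + 1 := by
  obtain ⟨hlower, hupper⟩ := h.challengerPulls_mem_Icc hβ hij n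
  rcases ha with rfl | rfl
  · have hadd := congrArg (Nat.cast (R := ℝ)) (h.card_leader_pulls_add_challengerPulls hij n)
    push_cast at hadd
    calc min β (1 - β) * pairCount B C n a j ≤ β * pairCount B C n a j := by
          gcongr
          exact min_le_left _ _
      _ ≤ _ := by linarith
  · calc min β (1 - β) * pairCount B C n i a ≤ (1 - β) * pairCount B C n i a := by
          gcongr
          exact min_le_right _ _
      _ ≤ challengerPulls I B C n i a := hlower
      _ ≤ _ := le_add_of_nonneg_right zero_le_one

theorem IsRun.card_pulls_le (h : IsRun ε₀ β I X B C) {d : ℝ} (hd : 0 ≤ d) (a : Fin K)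
    (n : ℕ) : (((Finset.Ico (K + 1) n).filter
      fun t => I t = a ∧ (pulls I t a : ℝ) ≤ d).card : ℝ) ≤ d := by
  have hinj : Set.InjOn (pulls I · a) {t | K < t ∧ I t = a} := by
    refine StrictMonoOn.injOn fun t ht s _ hts => ?_
    obtain ⟨hKt, rfl⟩ := ht
    exact pulls_lt_pulls (Nat.one_le_of_lt hKt) hts
  calc _ ≤ ((Finset.Icc 1 ⌊d⌋₊).card : ℝ) := by
        refine Nat.cast_le.2 (Finset.card_le_card_of_injOn (pulls I · a) ?_ (hinj.mono ?_)) <;>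
          intro t ht <;> obtain ⟨hmem, hpull, hle⟩ := Finset.mem_filter.1 ht <;>
          have hKt := (Finset.mem_Ico.1 hmem).1
        · exact Finset.mem_Icc.2 ⟨h.one_le_pulls hKt a, Nat.le_floor hle⟩
        · exact ⟨hKt, hpull⟩
    _ ≤ d := by
        rw [Nat.card_Icc, Nat.add_sub_cancel]
        exact Nat.floor_le hd

-- Either arm of the pair gets its share of the rounds, and the arm undersampled in the last round
-- of the pair was undersampled in all the earlier ones.
theorem IsRun.min_mul_pairCount_le_card_undersampled (h : IsRun ε₀ β I X B C)
    (hβ : β ∈ Set.Icc 0 1) {D : Fin K → ℝ} {i j : Fin K} (hij : i ≠ j) {n : ℕ}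
    (hU : ∀ t ∈ Finset.Ico (K + 1) n,
      (pulls I t (B t) : ℝ) ≤ D (B t) ∨ (pulls I t (C t) : ℝ) ≤ D (C t)) :
    min β (1 - β) * pairCount B C n i j ≤ (((Finset.Ico (K + 1) n).filter
      fun t => pulls I t (I t) ≤ D (I t)).filter fun t => (B t, C t) = (i, j)).card + 1 := by
  rcases ((Finset.Ico (K + 1) n).filter fun t => B t = i ∧ C t = j).eq_empty_or_nonempty
    with hempty | hne
  · rw [pairCount, hempty, Finset.card_empty, Nat.cast_zero, mul_zero]
    positivity
  obtain ⟨last, hlast, hmax⟩ := Finset.exists_max_image _ id hne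
  simp only [Finset.mem_filter] at hlast hmax
  obtain ⟨hmem_last, rfl, rfl⟩ := hlast
  obtain ⟨a, ha, haD⟩ : ∃ a, (a = B last ∨ a = C last) ∧ (pulls I last a : ℝ) ≤ D a := by
    rcases hU last hmem_last with hB | hC
    · exact ⟨_, Or.inl rfl, hB⟩
    · exact ⟨_, Or.inr rfl, hC⟩
  refine (h.min_mul_pairCount_le hβ hij ha n).trans ?_
  gcongr
  intro t ht
  simp only [Finset.mem_filter, Prod.mk.injEq] at ht ⊢
  obtain ⟨hmem, hB, hC, rfl⟩ := ht
  exact ⟨⟨hmem, (Nat.cast_le.2 (pulls_mono I _ (hmax t ⟨hmem, hB, hC⟩))).trans haD⟩, hB, hC⟩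

theorem IsRun.card_undersampled_le (h : IsRun ε₀ β I X B C) {D : Fin K → ℝ}
    (hD : ∀ k, 0 ≤ D k) (n : ℕ) :
    (((Finset.Ico (K + 1) n).filter fun t => pulls I t (I t) ≤ D (I t)).card : ℝ)
      ≤ ∑ k, D k := by
  rw [Finset.card_eq_sum_card_fiberwise (f := I) (t := Finset.univ) fun t _ =>
    Finset.mem_coe.2 (Finset.mem_univ _), Nat.cast_sum]
  refine Finset.sum_le_sum fun a _ => le_trans ?_ (h.card_pulls_le (hD a) a n)
  gcongr
  intro t ht
  simp only [Finset.mem_filter] at ht ⊢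
  obtain ⟨⟨hmem, hle⟩, rfl⟩ := ht
  exact ⟨hmem, rfl, hle⟩

theorem IsRun.min_mul_le_of_undersampled (h : IsRun ε₀ β I X B C) (hβ : β ∈ Set.Icc 0 1)
    {D : Fin K → ℝ} (hD : ∀ k, 0 ≤ D k) {n : ℕ}
    (hU : ∀ t ∈ Finset.Ico (K + 1) n,
      (pulls I t (B t) : ℝ) ≤ D (B t) ∨ (pulls I t (C t) : ℝ) ≤ D (C t)) :
    min β (1 - β) * (n - (K + 1)) ≤ ∑ k, D k + K * (K - 1) := by
  set pairs := (Finset.univ : Finset (Fin K)).offDiag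
  set rounds := Finset.Ico (K + 1) n
  set under := rounds.filter fun t => (pulls I t (I t) : ℝ) ≤ D (I t)
  have hmaps : ∀ t ∈ rounds, (B t, C t) ∈ pairs := fun t ht => by
    simpa [pairs] using (h.challenger_ne t (Finset.mem_Ico.1 ht).1).symm
  have hrounds : (rounds.card : ℝ) = ∑ p ∈ pairs, (pairCount B C n p.1 p.2 : ℝ) := by
    rw [Finset.card_eq_sum_card_fiberwise hmaps, Nat.cast_sum]
    simp only [pairCount, Prod.ext_iff, rounds]
  have hunder : (under.card : ℝ)
      = ∑ p ∈ pairs, ((under.filter fun t => (B t, C t) = p).card : ℝ) := by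
    rw [Finset.card_eq_sum_card_fiberwise fun t ht => hmaps t (Finset.mem_filter.1 ht).1,
      Nat.cast_sum]
  have hpairs : (pairs.card : ℝ) = K * (K - 1) := by
    rw [Finset.offDiag_card, Finset.card_univ, Fintype.card_fin,
      Nat.cast_sub (Nat.le_mul_self K), Nat.cast_mul]
    ring
  calc min β (1 - β) * (n - (K + 1)) ≤ min β (1 - β) * rounds.card := by
        gcongr
        · exact le_min hβ.1 (sub_nonneg.2 hβ.2)
        · rw [Nat.card_Ico, sub_le_iff_le_add]
          exact_mod_cast le_tsub_add
    _ = ∑ p ∈ pairs, min β (1 - β) * pairCount B C n p.1 p.2 := by rw [hrounds, Finset.mul_sum]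
    _ ≤ ∑ p ∈ pairs, (((under.filter fun t => (B t, C t) = p).card : ℝ) + 1) :=
        Finset.sum_le_sum fun p hp => h.min_mul_pairCount_le_card_undersampled hβ
          (Finset.mem_offDiag.1 hp).2.2 hU
    _ = under.card + pairs.card := by
        rw [Finset.sum_add_distrib, hunder, Finset.sum_const, nsmul_one]
    _ ≤ _ := by
        rw [hpairs]
        gcongr
        exact h.card_undersampled_le hD n

end Counting

section Concentration

variable {K : ℕ} {ε₀ β : ℝ} {I : ℕ → Fin K} {X : ℕ → ℝ} {B C : ℕ → Fin K} {μ : Fin K → ℝ}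
  {x : ℝ} {t : ℕ}

/-- The width `√(1/N_{t,i} + 1/N_{t,j})` of the comparison of the arms `i` and `j`, which is the
denominator of `transportCost`. -/
noncomputable def radius (I : ℕ → Fin K) (t : ℕ) (i j : Fin K) : ℝ :=
  √(1 / (pulls I t i : ℝ) + 1 / (pulls I t j : ℝ))

/-- The deviation of the empirical mean of the arm `i`, squared and multiplied by the number of
pulls: twice the Gaussian log-likelihood ratio. -/
noncomputable def sqDev (μ : Fin K → ℝ) (I : ℕ → Fin K) (X : ℕ → ℝ) (t : ℕ) (i : Fin K) : ℝ :=
  pulls I t i * (empMean I X t i - μ i) ^ 2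

/-- The empirical means of all pairs of arms are accurate at time `t`, at level `x`. -/
def Accurate (μ : Fin K → ℝ) (x : ℝ) (I : ℕ → Fin K) (X : ℕ → ℝ) (t : ℕ) : Prop :=
  ∀ i k, i ≠ k → sqDev μ I X t i + sqDev μ I X t k < 2 * x

-- Cauchy-Schwarz for the vectors `(√N a, -√M b)` and `(1/√N, 1/√M)`.
theorem sub_lt_of_weighted_sq_lt {N M a b : ℝ} (hN : 0 < N) (hM : 0 < M)
    (h : N * a ^ 2 + M * b ^ 2 < 2 * x) : a - b < √(2 * x) * √(1 / N + 1 / M) := by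
  have hcs : (a - b) ^ 2 ≤ (N * a ^ 2 + M * b ^ 2) * (1 / N + 1 / M) := by
    have hdefect : (N * a ^ 2 + M * b ^ 2) * (1 / N + 1 / M) - (a - b) ^ 2
        = (N * a + M * b) ^ 2 / (N * M) := by
      field_simp
      ring
    rw [← sub_nonneg, hdefect]
    positivity
  rw [← Real.sqrt_mul ((by positivity : 0 ≤ N * a ^ 2 + M * b ^ 2).trans h.le)]
  exact Real.lt_sqrt_of_sq_lt (hcs.trans_lt (mul_lt_mul_of_pos_right h (by positivity)))

theorem sqrt_mul_sqrt_one_div_add_le_one {N M c : ℝ} (hN : 0 < N) (hM : 0 < M) (hx : 0 ≤ x)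
    (hcN : 4 * x * c ^ 2 ≤ N) (hcM : 4 * x * c ^ 2 ≤ M) :
    √(2 * x) * c * √(1 / N + 1 / M) ≤ 1 := by
  refine le_of_abs_le ((sq_le_one_iff_abs_le_one _).1 ?_)
  calc (√(2 * x) * c * √(1 / N + 1 / M)) ^ 2
      = (4 * x * c ^ 2 / N + 4 * x * c ^ 2 / M) / 2 := by
        rw [mul_pow, mul_pow, Real.sq_sqrt (by positivity), Real.sq_sqrt (by positivity)]
        ring
    _ ≤ (1 + 1) / 2 := by
        gcongr
        · exact (div_le_one hN).2 hcN
        · exact (div_le_one hM).2 hcM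
    _ = 1 := by norm_num

theorem IsRun.pulls_pos (h : IsRun ε₀ β I X B C) (ht : K < t) (i : Fin K) :
    (0 : ℝ) < pulls I t i :=
  Nat.cast_pos.2 (h.one_le_pulls ht i)

theorem IsRun.radius_pos (h : IsRun ε₀ β I X B C) (ht : K < t) (i k : Fin K) :
    0 < radius I t i k := by
  have hi := h.pulls_pos ht i
  have hk := h.pulls_pos ht k
  exact Real.sqrt_pos.2 (by positivity)

theorem Accurate.empMean_sub_lt (hA : Accurate μ x I X t) (h : IsRun ε₀ β I X B C) (ht : K < t)
    {i k : Fin K} (hik : i ≠ k) :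
    empMean I X t i - empMean I X t k < μ i - μ k + √(2 * x) * radius I t i k := by
  have hdev : empMean I X t i - μ i - (empMean I X t k - μ k) < √(2 * x) * radius I t i k :=
    sub_lt_of_weighted_sq_lt (h.pulls_pos ht i) (h.pulls_pos ht k) (hA i k hik)
  linarith

theorem Accurate.sub_lt (hA : Accurate μ x I X t) (h : IsRun ε₀ β I X B C)
    (ht : K < t) {k : Fin K} (hk : B t ≠ k) : μ k - μ (B t) < √(2 * x) * radius I t (B t) k := by
  linarith [hA.empMean_sub_lt h ht hk, h.leader t ht k]

theorem Accurate.transportCost_lt (hA : Accurate μ x I X t) (h : IsRun ε₀ β I X B C)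
    (ht : K < t) {i k : Fin K} (hik : i ≠ k) :
    transportCost I X ε₀ t i k < (μ i - μ k + ε₀) / radius I t i k + √(2 * x) := by
  have hr := h.radius_pos ht i k
  calc transportCost I X ε₀ t i k
      < (μ i - μ k + √(2 * x) * radius I t i k + ε₀) / radius I t i k :=
        div_lt_div_of_pos_right (add_lt_add_left (hA.empMean_sub_lt h ht hik) ε₀) hr
    _ = (μ i - μ k + ε₀) / radius I t i k + √(2 * x) := by field_simp; ring

theorem IsRun.le_transportCost (h : IsRun ε₀ β I X B C) (hε : 0 < ε₀) (ht : K < t)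
    (hx : 0 ≤ x) {c : ℝ} (hB : 4 * x * c ^ 2 ≤ pulls I t (B t))
    (hC : 4 * x * c ^ 2 ≤ pulls I t (C t)) {k : Fin K} (hk : k ≠ B t) :
    ε₀ * (√(2 * x) * c) ≤ transportCost I X ε₀ t (B t) k := by
  have hr := h.radius_pos ht (B t) (C t)
  have hone : √(2 * x) * c * radius I t (B t) (C t) ≤ 1 :=
    sqrt_mul_sqrt_one_div_add_le_one (h.pulls_pos ht _) (h.pulls_pos ht _) hx hB hC
  calc ε₀ * (√(2 * x) * c) ≤ ε₀ * (1 / radius I t (B t) (C t)) := by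
        gcongr
        exact (le_div_iff₀ hr).2 hone
    _ = (0 + ε₀) / radius I t (B t) (C t) := by ring
    _ ≤ transportCost I X ε₀ t (B t) (C t) := by
        rw [transportCost, radius]
        gcongr
        exact sub_nonneg.2 (h.leader t ht (C t))
    _ ≤ transportCost I X ε₀ t (B t) k := h.challenger t ht k hk

theorem le_two_mul_sqrt_mul_radius {w : ℝ} {k : Fin K} (i : Fin K) (hw : 0 < w)
    (hpos : (0 : ℝ) < pulls I t k) (hk : (pulls I t k : ℝ) ≤ 4 * x * (1 / w) ^ 2) :
    w ≤ 2 * √(2 * x) * radius I t i k := by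
  have hle : pulls I t k * w ^ 2 ≤ 4 * x := by
    rwa [one_div_pow, mul_one_div, le_div_iff₀ (by positivity)] at hk
  have hx : 0 < x := by
    have : 0 < pulls I t k * w ^ 2 := by positivity
    linarith
  calc w ≤ √(4 * (2 * x) * (1 / (pulls I t i : ℝ) + 1 / (pulls I t k : ℝ))) := by
        refine Real.le_sqrt_of_sq_le ?_
        calc w ^ 2 ≤ 4 * x * (1 / (pulls I t k : ℝ)) := by
              rw [mul_one_div, le_div_iff₀ hpos]
              linarith
          _ ≤ 4 * (2 * x) * (1 / (pulls I t i : ℝ) + 1 / (pulls I t k : ℝ)) := by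
              gcongr
              · linarith
              · exact le_add_of_nonneg_left (by positivity)
    _ = 2 * √(2 * x) * radius I t i k := by
        rw [Real.sqrt_mul (by positivity), Real.sqrt_mul (by norm_num), radius,
          show (4 : ℝ) = 2 ^ 2 by norm_num, Real.sqrt_sq zero_le_two]

-- A poorly explored arm `k` is so cheap to confuse with the leader that the challenger, which is
-- at least as cheap, cannot be well explored together with the leader.
theorem IsRun.undersampled_of_bad_arm (h : IsRun ε₀ β I X B C) (hε : 0 < ε₀) (ht : K < t)
    (hx : 0 ≤ x) (hA : Accurate μ x I X t) {g w c : ℝ} {k : Fin K} (hg : 0 ≤ g) (hw : 0 < w)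
    (hgap : bestMean μ - μ k = w + g) (hc : 2 * ((g / ε₀ + 1) / w) + 3 / ε₀ ≤ c)
    (hk : (pulls I t k : ℝ) ≤ 4 * x * (1 / w) ^ 2) :
    (pulls I t (B t) : ℝ) ≤ 4 * x * c ^ 2 ∨ (pulls I t (C t) : ℝ) ≤ 4 * x * c ^ 2 := by
  by_contra! hcon
  obtain ⟨hB, hC⟩ := hcon
  have hwc : 1 / w ≤ c := by
    have hle : 1 / w ≤ 2 * ((g / ε₀ + 1) / w) := by
      rw [← mul_div_assoc]
      gcongr
      linarith [div_nonneg hg hε.le]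
    linarith [div_pos three_pos hε]
  have hkB : k ≠ B t := by
    rintro rfl
    have : 4 * x * (1 / w) ^ 2 ≤ 4 * x * c ^ 2 := by gcongr
    linarith
  have hr := h.radius_pos ht (B t) k
  have hwr := le_two_mul_sqrt_mul_radius (B t) hw (h.pulls_pos ht k) hk
  refine lt_irrefl (ε₀ * (√(2 * x) * c)) ?_
  calc ε₀ * (√(2 * x) * c) ≤ transportCost I X ε₀ t (B t) k :=
        h.le_transportCost hε ht hx hB.le hC.le hkB
    _ < (μ (B t) - μ k + ε₀) / radius I t (B t) k + √(2 * x) := hA.transportCost_lt h ht hkB.symm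
    _ ≤ (w + g + ε₀) / radius I t (B t) k + √(2 * x) := by
        gcongr
        linarith [le_bestMean μ (B t)]
    _ ≤ (w + g + ε₀) * (2 * √(2 * x) / w) + √(2 * x) := by
        rw [div_eq_mul_one_div]
        gcongr ?_ * ?_ + _
        rwa [div_le_div_iff₀ hr hw, one_mul]
    _ = ε₀ * (√(2 * x) * (2 * ((g / ε₀ + 1) / w) + 3 / ε₀)) := by field_simp; ring
    _ ≤ ε₀ * (√(2 * x) * c) := by gcongr

theorem IsRun.undersampled_of_bad_leader (h : IsRun ε₀ β I X B C) (hε : 0 < ε₀) (ht : K < t)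
    (hx : 0 ≤ x) (hA : Accurate μ x I X t) {m : ℝ} (hB : 0 < bestMean μ - μ (B t))
    (hm : 1 / (bestMean μ - μ (B t)) ≤ m) (hmε : 1 / ε₀ ≤ m) :
    (pulls I t (B t) : ℝ) ≤ 4 * x * m ^ 2 ∨ (pulls I t (C t) : ℝ) ≤ 4 * x * m ^ 2 := by
  by_contra! hcon
  have : NeZero K := ⟨(Fin.pos (B t)).ne'⟩
  obtain ⟨best, hbest⟩ := exists_eq_bestMean μ
  rw [← hbest] at hB hm
  have hne : best ≠ B t := by
    rintro rfl
    simp at hB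
  have hr := h.radius_pos ht (B t) best
  set y := √(2 * x)
  set regret := μ best - μ (B t) with hregret
  have hlt : regret < y * radius I t (B t) best := hA.sub_lt h ht hne.symm
  refine lt_irrefl (ε₀ * (y * m)) ?_
  calc ε₀ * (y * m) ≤ transportCost I X ε₀ t (B t) best :=
        h.le_transportCost hε ht hx hcon.1.le hcon.2.le hne
    _ < (μ (B t) - μ best + ε₀) / radius I t (B t) best + y := hA.transportCost_lt h ht hne.symm
    _ = (ε₀ - regret) / radius I t (B t) best + y := by rw [hregret]; ring
    _ ≤ ε₀ * (y * m) := ?_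
  rcases le_total ε₀ regret with hle | hle
  · calc (ε₀ - regret) / radius I t (B t) best + y ≤ 0 + 1 * y := by
          rw [one_mul]
          gcongr
          exact div_nonpos_of_nonpos_of_nonneg (sub_nonpos.2 hle) hr.le
      _ ≤ ε₀ * m * y + 0 := by
          rw [zero_add, add_zero]
          gcongr
          rwa [div_le_iff₀' hε] at hmε
      _ = ε₀ * (y * m) := by ring
  · calc (ε₀ - regret) / radius I t (B t) best + y ≤ (ε₀ - regret) * (y / regret) + y := by
          rw [div_eq_mul_one_div]
          gcongr ?_ * ?_ + _
          rw [div_le_div_iff₀ hr hB, one_mul]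
          exact hlt.le
      _ = ε₀ * (y * (1 / regret)) := by field_simp; ring
      _ ≤ ε₀ * (y * m) := by gcongr

theorem IsRun.pulls_lt_of_le_pulls_leader (h : IsRun ε₀ β I X B C) (ht : K < t) (hx : 0 ≤ x)
    (hA : Accurate μ x I X t) {w : ℝ} (hw : 0 < w) {k : Fin K} (hk : w ≤ μ k - μ (B t))
    (hB : 4 * x * (1 / w) ^ 2 ≤ pulls I t (B t)) :
    (pulls I t k : ℝ) < 4 * x * (1 / w) ^ 2 := by
  by_contra! hle
  have hne : B t ≠ k := by
    rintro rfl
    linarith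
  have hone : √(2 * x) * (1 / w) * radius I t (B t) k ≤ 1 :=
    sqrt_mul_sqrt_one_div_add_le_one (h.pulls_pos ht _) (h.pulls_pos ht _) hx hB hle
  rw [mul_one_div, div_mul_eq_mul_div, div_le_one hw] at hone
  linarith [hA.sub_lt h ht hne]

end Concentration

section GoodRecommendation

variable {K : ℕ} [NeZero K] {ε₀ β : ℝ} {I : ℕ → Fin K} {X : ℕ → ℝ} {B C : ℕ → Fin K}
  {μ : Fin K → ℝ} {x : ℝ} {n i j : ℕ}

theorem IsRun.min_mul_le_hBar (h : IsRun ε₀ β I X B C) (hβ : β ∈ Set.Icc 0 1) (hε : 0 < ε₀)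
    (hx : 0 ≤ x) (hA : ∀ t ∈ Finset.Icc (K + 1) n, Accurate μ x I X t)
    (hj : j ∈ Finset.Icc 1 i) (hi : i < numClasses μ) {k : Fin K}
    (hbad : gap μ (i + 1) ≤ bestMean μ - μ k)
    (hpulls : (pulls I n k : ℝ) ≤ 4 * x * (1 / (bestMean μ - μ k - gap μ j)) ^ 2) :
    min β (1 - β) * (n - (K + 1)) ≤ 4 * x * hBar μ ε₀ i j + K * (K - 1) := by
  have hd := gap_sub_gap_pos μ hj hi
  have hg := gap_nonneg_of_mem_Icc μ hj hi
  have hdw : gap μ (i + 1) - gap μ j ≤ bestMean μ - μ k - gap μ j := by gcongr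
  have hundersampled := h.min_mul_le_of_undersampled hβ
    (D := fun _ => 4 * x * cTwo μ ε₀ (i + 1) j ^ 2) (fun _ => by positivity) fun t ht => by
      have ht' := Finset.mem_Ico.1 ht
      refine h.undersampled_of_bad_arm hε ht'.1 hx (hA t (Finset.mem_Icc.2 ⟨ht'.1, ht'.2.le⟩)) hg
        (hd.trans_le hdw) (sub_add_cancel _ _).symm ?_
        ((Nat.cast_le.2 (pulls_mono I k ht'.2.le)).trans hpulls)
      rw [cTwo]
      gcongr
  calc min β (1 - β) * (n - (K + 1))
      ≤ ∑ _ : Fin K, 4 * x * cTwo μ ε₀ (i + 1) j ^ 2 + K * (K - 1) := hundersampled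
    _ = 4 * x * (K * cTwo μ ε₀ (i + 1) j ^ 2) + K * (K - 1) := by
        rw [Finset.sum_const, Finset.card_univ, Fintype.card_fin, nsmul_eq_mul, mul_left_comm]
    _ ≤ 4 * x * hBar μ ε₀ i j + K * (K - 1) := by
        gcongr
        exact le_hBar μ hε hj hi

theorem IsRun.min_mul_le_hTilde (h : IsRun ε₀ β I X B C) (hβ : β ∈ Set.Icc 0 1) (hε : 0 < ε₀)
    (hx : 0 ≤ x) (hA : ∀ t ∈ Finset.Icc (K + 1) n, Accurate μ x I X t)
    (hj : j ∈ Finset.Icc 1 i) (hi : i < numClasses μ)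
    (hpulls : ∀ k, bestMean μ - μ k ≤ gap μ j →
      (pulls I n k : ℝ) ≤ 4 * x * (1 / (gap μ (i + 1) - gap μ j)) ^ 2) :
    min β (1 - β) * (n - (K + 1)) ≤ 4 * x * hTilde μ ε₀ i j + K * (K - 1) := by
  have hj' := Finset.mem_Icc.1 hj
  have hjC : j ∈ Finset.Icc 1 (numClasses μ) := Finset.mem_Icc.2 ⟨hj'.1, by lia⟩
  have hgap := gap_add_one_pos μ hj hi
  set near := 4 * x * (1 / (gap μ (i + 1) - gap μ j)) ^ 2 with hnear
  set far := 4 * x * max (cOne μ ε₀ (j + 1)) (1 / ε₀) ^ 2 with hfar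
  have hundersampled := h.min_mul_le_of_undersampled hβ (n := n)
    (D := fun k => if bestMean μ - μ k ≤ gap μ j then near else far)
    (fun k => by split_ifs <;> positivity) fun t ht => by
      have ht' := Finset.mem_Ico.1 ht
      have hmono := fun k => Nat.cast_le (α := ℝ).2 (pulls_mono I k ht'.2.le)
      by_cases hB : bestMean μ - μ (B t) ≤ gap μ j
      · exact Or.inl ((hmono _).trans ((hpulls _ hB).trans (if_pos hB).ge))
      by_cases hC : bestMean μ - μ (C t) ≤ gap μ j
      · exact Or.inr ((hmono _).trans ((hpulls _ hC).trans (if_pos hC).ge))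
      rw [if_neg hB, if_neg hC]
      have hregret := gap_add_one_le_of_lt μ (Finset.mem_Icc.1 hjC) (not_le.1 hB)
      exact h.undersampled_of_bad_leader hε ht'.1 hx
        (hA t (Finset.mem_Icc.2 ⟨ht'.1, ht'.2.le⟩)) (hgap.trans_le hregret)
        ((one_div_le_one_div_of_le hgap hregret).trans (one_div_gap_le_max_cOne μ))
        (le_max_right _ _)
  refine hundersampled.trans ?_
  gcongr
  rw [sum_ite_le_gap μ hjC, hnear, hfar, mul_left_comm, mul_left_comm _ (4 * x), ← mul_add]
  gcongr
  exact le_hTilde μ hε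

theorem IsRun.regret_lt_gap (h : IsRun ε₀ β I X B C) (hβ : β ∈ Set.Icc 0 1) (hε : 0 < ε₀)
    (hn : K < n) (hx : 0 ≤ x) (hA : ∀ t ∈ Finset.Icc (K + 1) n, Accurate μ x I X t)
    (h_one : 1 ≤ i) (hi : i < numClasses μ)
    (hlt : 4 * x * complexity μ ε₀ i + K * (K - 1) < min β (1 - β) * (n - (K + 1))) :
    bestMean μ - μ (B n) < gap μ (i + 1) := by
  by_contra! hbad
  obtain ⟨j, hj, hcomplexity⟩ := exists_complexity_eq μ (ε₀ := ε₀) h_one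
  have hd := gap_sub_gap_pos μ hj hi
  have hdw : gap μ (i + 1) - gap μ j ≤ bestMean μ - μ (B n) - gap μ j := by gcongr
  have hw := hd.trans_le hdw
  refine absurd hlt (not_lt.2 ?_)
  rw [← hcomplexity]
  rcases le_total (pulls I n (B n) : ℝ) (4 * x * (1 / (bestMean μ - μ (B n) - gap μ j)) ^ 2)
    with hle | hge
  · refine (h.min_mul_le_hBar hβ hε hx hA hj hi hbad hle).trans ?_
    gcongr
    exact le_max_left _ _
  · refine (h.min_mul_le_hTilde hβ hε hx hA hj hi fun k hk => ?_).trans ?_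
    · calc (pulls I n k : ℝ) ≤ 4 * x * (1 / (bestMean μ - μ (B n) - gap μ j)) ^ 2 :=
            (h.pulls_lt_of_le_pulls_leader hn hx (hA n (Finset.mem_Icc.2 ⟨hn, le_rfl⟩))
              hw (by linarith) hge).le
        _ ≤ 4 * x * (1 / (gap μ (i + 1) - gap μ j)) ^ 2 := by gcongr
    · gcongr
      exact le_max_right _ _

end GoodRecommendation

section ESupermartingale

variable {Ω : Type*} {mΩ : MeasurableSpace Ω} {P : Measure Ω} {𝓕 : Filtration ℕ mΩ}

/-- Supermartingales with values in `[0, ∞]`, for which Ville's inequality holds. In contrast to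
`Supermartingale`, no integrability is asked for, so that mixtures stay in the class. -/
structure ESupermartingale (Z : ℕ → Ω → ENNReal) (𝓕 : Filtration ℕ mΩ) (P : Measure Ω) :
    Prop where
  measurable : ∀ r, Measurable[𝓕 r] (Z r)
  setLIntegral_succ_le : ∀ r A, MeasurableSet[𝓕 r] A →
    ∫⁻ ω in A, Z (r + 1) ω ∂P ≤ ∫⁻ ω in A, Z r ω ∂P

theorem ESupermartingale.mul_measure_exists_lt_le {Z : ℕ → Ω → ENNReal}
    (hZ : ESupermartingale Z 𝓕 P) (w : ENNReal) (n : ℕ) :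
    w * P {ω | ∃ r < n, w ≤ Z r ω} ≤ ∫⁻ ω, Z 0 ω ∂P := by
  set below : ℕ → Set Ω := fun r => {ω | ∀ q < r, Z q ω < w}
  have hbelow : ∀ r, MeasurableSet[𝓕 r] (below r) := fun r => by
    simp only [below, Set.ofPred_forall]
    exact .iInter fun q => .iInter fun hq =>
      measurableSet_lt ((hZ.measurable q).mono (𝓕.mono hq.le) le_rfl) measurable_const
  suffices h : w * P {ω | ∃ r < n, w ≤ Z r ω} + ∫⁻ ω in below n, Z n ω ∂P ≤ ∫⁻ ω, Z 0 ω ∂P from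
    le_self_add.trans h
  induction n with
  | zero => simp [below]
  | succ n ih =>
    set hit := {ω | w ≤ Z n ω}
    have hhit : MeasurableSet[𝓕 n] hit := measurableSet_le measurable_const (hZ.measurable n)
    have hexists : {ω | ∃ r < n + 1, w ≤ Z r ω} ⊆ {ω | ∃ r < n, w ≤ Z r ω} ∪ below n ∩ hit := by
      rintro ω ⟨r, hr, hω⟩
      by_cases hlt : ∃ q < n, w ≤ Z q ω
      · exact Or.inl hlt
      push Not at hlt
      obtain rfl : r = n := Nat.eq_of_lt_succ_of_not_lt hr fun h => (hlt r h).not_ge hω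
      exact Or.inr ⟨hlt, hω⟩
    have hbelow_succ : below (n + 1) = below n \ hit := by
      ext ω
      simp [below, hit, Nat.le_iff_lt_or_eq, or_imp, forall_and]
    have hmarkov : w * P (below n ∩ hit) ≤ ∫⁻ ω in below n ∩ hit, Z n ω ∂P := by
      rw [← setLIntegral_const]
      exact setLIntegral_mono ((hZ.measurable n).mono (𝓕.le n) le_rfl) fun ω hω => hω.2
    calc w * P {ω | ∃ r < n + 1, w ≤ Z r ω} + ∫⁻ ω in below (n + 1), Z (n + 1) ω ∂P
        ≤ w * (P {ω | ∃ r < n, w ≤ Z r ω} + P (below n ∩ hit))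
            + ∫⁻ ω in below n \ hit, Z n ω ∂P := by
          gcongr w * ?_ + ?_
          · exact (measure_mono hexists).trans (measure_union_le _ _)
          · rw [hbelow_succ]
            exact hZ.setLIntegral_succ_le n _ ((hbelow n).diff hhit)
      _ ≤ w * P {ω | ∃ r < n, w ≤ Z r ω}
            + (∫⁻ ω in below n ∩ hit, Z n ω ∂P + ∫⁻ ω in below n \ hit, Z n ω ∂P) := by
          rw [mul_add, add_assoc]
          gcongr
      _ = w * P {ω | ∃ r < n, w ≤ Z r ω} + ∫⁻ ω in below n, Z n ω ∂P := by
          rw [lintegral_inter_add_sdiff _ _ (𝓕.le n _ hhit)]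
      _ ≤ ∫⁻ ω, Z 0 ω ∂P := ih

theorem ESupermartingale.mul_measure_exists_le {Z : ℕ → Ω → ENNReal}
    (hZ : ESupermartingale Z 𝓕 P) (w : ENNReal) :
    w * P {ω | ∃ r, w ≤ Z r ω} ≤ ∫⁻ ω, Z 0 ω ∂P := by
  have hunion : {ω | ∃ r, w ≤ Z r ω} = ⋃ n, {ω | ∃ r < n, w ≤ Z r ω} := by
    ext ω
    simp only [Set.mem_iUnion, Set.mem_ofPred_eq]
    exact ⟨fun ⟨r, h⟩ => ⟨r + 1, r, r.lt_succ_self, h⟩, fun ⟨_, r, _, h⟩ => ⟨r, h⟩⟩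
  have hmono : Monotone fun n => {ω | ∃ r < n, w ≤ Z r ω} :=
    fun _ _ hmn _ ⟨r, hr, h⟩ => ⟨r, hr.trans_le hmn, h⟩
  rw [hunion, hmono.measure_iUnion, ENNReal.mul_iSup]
  exact iSup_le (hZ.mul_measure_exists_lt_le w)

theorem ESupermartingale.lintegral [SFinite P] {Λ : Type*} [MeasurableSpace Λ] {ρ : Measure Λ}
    [SFinite ρ] {Z : Λ → ℕ → Ω → ENNReal} (hZ : ∀ l, ESupermartingale (Z l) 𝓕 P)
    (hm : ∀ r, @Measurable _ _ ((𝓕 r).prod inferInstance) _ fun p : Ω × Λ => Z p.2 r p.1) :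
    ESupermartingale (fun r ω => ∫⁻ l, Z l r ω ∂ρ) 𝓕 P where
  measurable r := @Measurable.lintegral_prod_right' _ _ (𝓕 r) _ _ _ _ (hm r)
  setLIntegral_succ_le r A hA := by
    have hm' : ∀ r, Measurable fun p : Ω × Λ => Z p.2 r p.1 := fun r =>
      (hm r).mono (sup_le_sup_right (MeasurableSpace.comap_mono (𝓕.le r)) _) le_rfl
    rw [lintegral_lintegral_swap (f := fun ω l => Z l (r + 1) ω) (hm' (r + 1)).aemeasurable,
      lintegral_lintegral_swap (f := fun ω l => Z l r ω) (hm' r).aemeasurable]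
    exact lintegral_mono fun l => (hZ l).setLIntegral_succ_le r A hA

end ESupermartingale

section CondDistrib

variable {Ω S E : Type*} {m mΩ : MeasurableSpace Ω} [MeasurableSpace S] [MeasurableSpace E]
  {P : Measure Ω} [IsFiniteMeasure P] {κ : Kernel S E} {V : Ω → S} {Y : Ω → E}

theorem hasCondDistrib_of_condExp [IsFiniteKernel κ] (hm : m ≤ mΩ) (hV : Measurable[m] V)
    (hY : Measurable Y)
    (hκ : ∀ s, MeasurableSet s → P⟦Y ⁻¹' s | m⟧ =ᵐ[P] fun ω => (κ (V ω)).real s) :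
    HasCondDistrib Y V κ P := by
  have hV' : Measurable V := hV.mono hm le_rfl
  refine ⟨by fun_prop, Measure.ext_prod fun {A s} hA hs => ?_⟩
  have hreal : ∫ ω in V ⁻¹' A, (κ (V ω)).real s ∂P = P.real (V ⁻¹' A ∩ Y ⁻¹' s) := by
    calc ∫ ω in V ⁻¹' A, (κ (V ω)).real s ∂P = ∫ ω in V ⁻¹' A, (P⟦Y ⁻¹' s | m⟧) ω ∂P :=
          setIntegral_congr_ae (hV' hA) ((hκ s hs).mono fun _ h _ => h.symm)
      _ = ∫ ω in V ⁻¹' A, (Y ⁻¹' s).indicator (fun _ => (1 : ℝ)) ω ∂P :=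
          setIntegral_condExp hm ((integrable_const 1).indicator (hY hs)) (hV hA)
      _ = P.real (V ⁻¹' A ∩ Y ⁻¹' s) := by
          rw [setIntegral_indicator (hY hs), setIntegral_one_eq_measureReal]
  have hint : Integrable (fun ω => (κ (V ω)).real s) (P.restrict (V ⁻¹' A)) :=
    (integrable_condExp.congr (hκ s hs)).restrict
  rw [Measure.map_apply (by fun_prop) (hA.prod hs), Measure.compProd_apply_prod hA hs,
    setLIntegral_map hA (κ.measurable_coe hs) hV', ← ofReal_measureReal, Set.mk_preimage_prod,
    ← hreal, ofReal_integral_eq_lintegral_ofReal hint (.of_forall fun _ => measureReal_nonneg)]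
  exact lintegral_congr fun _ => ofReal_measureReal

theorem lintegral_eq_lintegral_lintegral_of_hasCondDistrib [IsSFiniteKernel κ]
    (h : HasCondDistrib Y V κ P) {f : S × E → ENNReal} (hf : Measurable f) :
    ∫⁻ ω, f (V ω, Y ω) ∂P = ∫⁻ ω, ∫⁻ y, f (V ω, y) ∂κ (V ω) ∂P := by
  rw [← lintegral_map' (f := f) hf.aemeasurable h.aemeasurable, h.map_eq,
    Measure.lintegral_compProd hf,
    lintegral_map' hf.lintegral_kernel_prod_right'.aemeasurable h.aemeasurable_fst]

end CondDistrib

section GaussianMixture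

open Real

theorem lintegral_exp_gaussianReal {v : NNReal} (hv : v ≠ 0) (s : ℝ) {N : ℝ} (hN : 0 ≤ N) :
    ∫⁻ l, ENNReal.ofReal (exp (l * s - l ^ 2 * N / 2)) ∂gaussianReal 0 v
      = ENNReal.ofReal ((√(1 + v * N))⁻¹ * exp (v * s ^ 2 / (2 * (1 + v * N)))) := by
  have : (0 : ℝ) < v := NNReal.coe_pos.2 (pos_iff_ne_zero.2 hv)
  set u : NNReal := v / (1 + v * N.toNNReal) with hu
  have hu_coe : (u : ℝ) = v / (1 + v * N) := by simp [hu, hN]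
  have hu_ne : u ≠ 0 := by
    rw [← NNReal.coe_ne_zero, hu_coe]
    positivity
  have hpdf : ∀ l, gaussianPDF 0 v l * ENNReal.ofReal (exp (l * s - l ^ 2 * N / 2))
      = ENNReal.ofReal ((√(1 + v * N))⁻¹ * exp (v * s ^ 2 / (2 * (1 + v * N))))
        * gaussianPDF (u * s) u l := fun l => by
    have hconst : (√(2 * π * v))⁻¹ = (√(1 + v * N))⁻¹ * (√(2 * π * u))⁻¹ := by
      rw [hu_coe, ← mul_inv, ← Real.sqrt_mul (by positivity)]
      congr 2
      field_simp
    have hexponent : -(l - 0) ^ 2 / (2 * v) + (l * s - l ^ 2 * N / 2)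
        = v * s ^ 2 / (2 * (1 + v * N)) + -(l - u * s) ^ 2 / (2 * u) := by
      rw [hu_coe]
      field_simp
      ring
    rw [gaussianPDF, gaussianPDF, ← ENNReal.ofReal_mul (gaussianPDFReal_nonneg _ _ _),
      ← ENNReal.ofReal_mul (by positivity), gaussianPDFReal, gaussianPDFReal, hconst, mul_assoc,
      ← exp_add, hexponent, exp_add]
    ring_nf
  rw [gaussianReal_of_var_ne_zero _ hv, lintegral_withDensity_eq_lintegral_mul _
    (measurable_gaussianPDF _ _) (by fun_prop)]
  simp only [Pi.mul_apply]
  rw [lintegral_congr hpdf,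
    lintegral_const_mul _ (measurable_gaussianPDF _ _), lintegral_gaussianPDF_eq_one _ hu_ne,
    mul_one]

-- The variance `(x - 1) / a` makes the exponent `(1 - 1 / x) (s² / (2 N))` when `N = a`, which
-- loses only a factor `e` at `s² / (2 N) = x`.
theorem le_lintegral_exp_gaussianReal {x a N : ℝ} (hx : 1 < x) (ha : 0 < a)
    (hN : N ∈ Set.Icc a (exp 1 * a)) (s : ℝ) :
    ENNReal.ofReal ((√(exp 1 * x))⁻¹ * exp ((x - 1) / x * (s ^ 2 / (2 * N))))
      ≤ ∫⁻ l, ENNReal.ofReal (exp (l * s - l ^ 2 * N / 2))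
          ∂gaussianReal 0 ((x - 1) / a).toNNReal := by
  have hN_pos : 0 < N := ha.trans_le hN.1
  have hx' : 0 < x - 1 := sub_pos.2 hx
  rw [lintegral_exp_gaussianReal (by simpa using div_pos hx' ha) s hN_pos.le,
    coe_toNNReal _ (by positivity)]
  apply ENNReal.ofReal_le_ofReal
  gcongr ?_⁻¹ * exp ?_
  · have he : 1 ≤ exp 1 := one_le_exp zero_le_one
    refine Real.sqrt_le_sqrt ?_
    calc 1 + (x - 1) / a * N ≤ exp 1 + (x - 1) / a * (exp 1 * a) := by
          gcongr
          exact hN.2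
      _ = exp 1 * x := by field_simp; ring
  · have hle : 1 + (x - 1) / a * N ≤ N / a * x := by
      have : 1 ≤ N / a := (one_le_div ha).2 hN.1
      calc 1 + (x - 1) / a * N = 1 + N / a * (x - 1) := by ring
        _ ≤ N / a + N / a * (x - 1) := by gcongr
        _ = N / a * x := by ring
    calc (x - 1) / x * (s ^ 2 / (2 * N)) = (x - 1) / a * s ^ 2 / (2 * (N / a * x)) := by
          field_simp
      _ ≤ (x - 1) / a * s ^ 2 / (2 * (1 + (x - 1) / a * N)) := by gcongr

theorem inv_le_lintegral_mul_lintegral_exp_gaussianReal {x a b N M : ℝ} (hx : 1 < x)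
    (ha : 0 < a) (hb : 0 < b) (hN : N ∈ Set.Icc a (exp 1 * a)) (hM : M ∈ Set.Icc b (exp 1 * b))
    {s s' : ℝ} (hs : 2 * x ≤ s ^ 2 / N + s' ^ 2 / M) :
    (ENNReal.ofReal (exp 2 * (x * exp (-x))))⁻¹
      ≤ (∫⁻ l, ENNReal.ofReal (exp (l * s - l ^ 2 * N / 2))
            ∂gaussianReal 0 ((x - 1) / a).toNNReal)
        * ∫⁻ l, ENNReal.ofReal (exp (l * s' - l ^ 2 * M / 2))
            ∂gaussianReal 0 ((x - 1) / b).toNNReal := by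
  have hx₀ : 0 < x := one_pos.trans hx
  refine le_trans ?_ (mul_le_mul' (le_lintegral_exp_gaussianReal hx ha hN s)
    (le_lintegral_exp_gaussianReal hx hb hM s'))
  rw [← ENNReal.ofReal_inv_of_pos (by positivity), ← ENNReal.ofReal_mul (by positivity)]
  apply ENNReal.ofReal_le_ofReal
  calc (exp 2 * (x * exp (-x)))⁻¹ = (exp 1 * x)⁻¹ * exp (x - 1) := by
        rw [mul_inv, mul_inv, mul_inv, ← exp_neg, ← exp_neg, ← exp_neg, mul_left_comm, ← exp_add,
          mul_comm _ x⁻¹, mul_assoc, ← exp_add]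
        ring_nf
    _ = (exp 1 * x)⁻¹ * exp ((x - 1) / x * x) := by rw [div_mul_cancel₀ _ hx₀.ne']
    _ ≤ (exp 1 * x)⁻¹ * exp ((x - 1) / x * (s ^ 2 / (2 * N) + s' ^ 2 / (2 * M))) := by
        have : 0 ≤ (x - 1) / x := div_nonneg (sub_nonneg.2 hx.le) hx₀.le
        gcongr
        rw [mul_comm 2 N, mul_comm 2 M, ← div_div, ← div_div]
        linarith
    _ = _ := by
        rw [mul_mul_mul_comm, ← mul_inv, Real.mul_self_sqrt (by positivity), ← exp_add, mul_add]

end GaussianMixture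

section ExpWeight

variable {K : ℕ}

/-- The sum of the centred rewards of the arm `i` before time `n`. -/
noncomputable def devSum (μ : Fin K → ℝ) (I : ℕ → Fin K) (X : ℕ → ℝ) (n : ℕ) (i : Fin K) : ℝ :=
  ∑ t ∈ (Finset.Ico 1 n).filter (fun t => I t = i), (X t - μ i)

/-- The exponential weight at time `n` which tilts the rewards of each arm `a` by `l a`. -/
noncomputable def expWeight (μ l : Fin K → ℝ) (I : ℕ → Fin K) (X : ℕ → ℝ) (n : ℕ) : ENNReal :=
  ENNReal.ofReal (Real.exp
    (∑ t ∈ Finset.Ico 1 n, (l (I t) * (X t - μ (I t)) - l (I t) ^ 2 / 2)))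

/-- At some time at which the arms `i` and `k` have been pulled about `a` and `b` times, within a
factor `e`, their empirical means are not accurate at level `x`. -/
def InaccurateNear (μ : Fin K → ℝ) (x : ℝ) (I : ℕ → Fin K) (X : ℕ → ℝ) (i k : Fin K) (a b : ℝ) :
    Prop :=
  ∃ t, (pulls I t i : ℝ) ∈ Set.Icc a (Real.exp 1 * a) ∧
    (pulls I t k : ℝ) ∈ Set.Icc b (Real.exp 1 * b) ∧ 2 * x ≤ sqDev μ I X t i + sqDev μ I X t k

variable (μ l : Fin K → ℝ) (I : ℕ → Fin K) (X : ℕ → ℝ) (n : ℕ)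

theorem sqDev_eq_sq_div (i : Fin K) : sqDev μ I X n i = devSum μ I X n i ^ 2 / pulls I n i := by
  have hsum : devSum μ I X n i
      = ∑ t ∈ (Finset.Ico 1 n).filter (fun t => I t = i), X t - pulls I n i * μ i := by
    rw [devSum, Finset.sum_sub_distrib, Finset.sum_const, nsmul_eq_mul, pulls]
  rcases eq_or_ne (pulls I n i : ℝ) 0 with h | h
  · rw [sqDev, h, zero_mul, div_zero]
  · rw [sqDev, hsum, empMean]
    field_simp

theorem expWeight_eq : expWeight μ l I X n = ENNReal.ofReal (Real.exp
    (∑ a, (l a * devSum μ I X n a - l a ^ 2 * pulls I n a / 2))) := by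
  rw [expWeight, ← Finset.sum_fiberwise _ I]
  congr 2
  refine Finset.sum_congr rfl fun a _ => ?_
  calc ∑ t ∈ (Finset.Ico 1 n).filter (fun t => I t = a),
        (l (I t) * (X t - μ (I t)) - l (I t) ^ 2 / 2)
      = ∑ t ∈ (Finset.Ico 1 n).filter (fun t => I t = a), (l a * (X t - μ a) - l a ^ 2 / 2) :=
        Finset.sum_congr rfl fun t ht => by rw [(Finset.mem_filter.1 ht).2]
    _ = l a * devSum μ I X n a - l a ^ 2 * pulls I n a / 2 := by
        rw [Finset.sum_sub_distrib, ← Finset.mul_sum, Finset.sum_const, nsmul_eq_mul, devSum,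
          pulls]
        ring

theorem expWeight_single_add_single {i k : Fin K} (hik : i ≠ k) (p q : ℝ) :
    expWeight μ (Pi.single i p + Pi.single k q) I X n
      = ENNReal.ofReal (Real.exp (p * devSum μ I X n i - p ^ 2 * pulls I n i / 2))
        * ENNReal.ofReal (Real.exp (q * devSum μ I X n k - q ^ 2 * pulls I n k / 2)) := by
  rw [expWeight_eq, ← ENNReal.ofReal_mul (Real.exp_pos _).le, ← Real.exp_add,
    Finset.sum_eq_add i k hik (fun a _ ha => by simp [ha.1, ha.2]) (by simp) (by simp)]
  simp [hik, hik.symm]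

theorem expWeight_succ (hn : 1 ≤ n) : expWeight μ l I X (n + 1) = expWeight μ l I X n *
    ENNReal.ofReal (Real.exp (l (I n) * (X n - μ (I n)) - l (I n) ^ 2 / 2)) := by
  rw [expWeight, expWeight, Finset.sum_Ico_succ_top hn, Real.exp_add,
    ENNReal.ofReal_mul (Real.exp_pos _).le]

theorem expWeight_one : expWeight μ l I X 1 = 1 := by simp [expWeight]

theorem IsOneSubGaussian.lintegral_exp_le_one {ρ : Measure ℝ} [IsProbabilityMeasure ρ]
    (h : IsOneSubGaussian ρ) (c : ℝ) :
    ∫⁻ y, ENNReal.ofReal (Real.exp (c * (y - ∫ z, z ∂ρ) - c ^ 2 / 2)) ∂ρ ≤ 1 := by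
  have hmgf : ∫ y, Real.exp (c * (y - ∫ z, z ∂ρ)) ∂ρ ≤ Real.exp (c ^ 2 / 2) := by
    simpa [mgf] using h.mgf_le c
  simp only [Real.exp_sub]
  rw [← ofReal_integral_eq_lintegral_ofReal ((h.integrable_exp_mul c).div_const _)
    (.of_forall fun y => by positivity), integral_div, ENNReal.ofReal_le_one,
    div_le_one (Real.exp_pos _)]
  exact hmgf

end ExpWeight

theorem measurable_ofReal_exp_mul_sub {Ω Λ : Type*} {m : MeasurableSpace Ω} [MeasurableSpace Λ]
    {S N : Ω → ℝ} (hS : Measurable S) (hN : Measurable N) {f : Λ → ℝ} (hf : Measurable f) :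
    Measurable fun p : Ω × Λ =>
      ENNReal.ofReal (Real.exp (f p.2 * S p.1 - f p.2 ^ 2 * N p.1 / 2)) := by
  fun_prop

section Deviation

variable {K : ℕ} {Ω : Type*} [mΩ : MeasurableSpace Ω] {P : Measure Ω} {ν : Fin K → Measure ℝ}
  {ε₀ β : ℝ} {𝓕 : Filtration ℕ mΩ} {I : ℕ → Ω → Fin K} {X : ℕ → Ω → ℝ} {B C : ℕ → Ω → Fin K}

theorem IsEBTC.measurable_arm_of_mem_Ico (h : IsEBTC P ν ε₀ β 𝓕 I X B C) {r t : ℕ}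
    (ht : t ∈ Finset.Ico 1 (r + 1)) : Measurable[𝓕 r] (I t) := by
  obtain ⟨ht₁, htr⟩ := Finset.mem_Ico.1 ht
  obtain ⟨q, rfl⟩ := Nat.exists_eq_add_of_le' ht₁
  exact (h.measurable_arm q).mono (𝓕.mono (by lia)) le_rfl

theorem IsEBTC.measurable_reward_of_mem_Ico (h : IsEBTC P ν ε₀ β 𝓕 I X B C) {r t : ℕ}
    (ht : t ∈ Finset.Ico 1 (r + 1)) : Measurable[𝓕 r] (X t) := by
  obtain ⟨ht₁, htr⟩ := Finset.mem_Ico.1 ht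
  obtain ⟨q, rfl⟩ := Nat.exists_eq_add_of_le' ht₁
  exact (h.measurable_reward q).mono (𝓕.mono (by lia)) le_rfl

theorem IsEBTC.measurable_pulls (h : IsEBTC P ν ε₀ β 𝓕 I X B C) (r : ℕ) (i : Fin K) :
    Measurable[𝓕 r] fun ω => (pulls (I · ω) (r + 1) i : ℝ) := by
  simp only [pulls, Finset.card_filter, Nat.cast_sum]
  exact Finset.measurable_fun_sum _ fun t ht => measurable_from_nat.comp <|
    .ite (h.measurable_arm_of_mem_Ico ht (measurableSet_singleton i)) measurable_const
      measurable_const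

theorem IsEBTC.measurable_devSum (h : IsEBTC P ν ε₀ β 𝓕 I X B C) (μ : Fin K → ℝ) (r : ℕ)
    (i : Fin K) : Measurable[𝓕 r] fun ω => devSum μ (I · ω) (X · ω) (r + 1) i := by
  simp only [devSum, Finset.sum_filter]
  exact Finset.measurable_fun_sum _ fun t ht =>
    .ite (h.measurable_arm_of_mem_Ico ht (measurableSet_singleton i))
      ((h.measurable_reward_of_mem_Ico ht).sub_const _) measurable_const

theorem IsEBTC.measurable_expWeight (h : IsEBTC P ν ε₀ β 𝓕 I X B C) (μ l : Fin K → ℝ) (r : ℕ) :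
    Measurable[𝓕 r] fun ω => expWeight μ l (I · ω) (X · ω) (r + 1) := by
  simp only [expWeight_eq]
  exact (Finset.measurable_fun_sum _ fun a _ => ((h.measurable_devSum μ r a).const_mul _).sub
    (((h.measurable_pulls r a).const_mul _).div_const _)).exp.ennreal_ofReal

theorem IsEBTC.measurable_expWeight_single_add_single (h : IsEBTC P ν ε₀ β 𝓕 I X B C)
    (μ : Fin K → ℝ) {i k : Fin K} (hik : i ≠ k) (r : ℕ) :
    @Measurable _ _ ((𝓕 r).prod inferInstance) _ fun p : Ω × ℝ × ℝ =>
      expWeight μ (Pi.single i p.2.1 + Pi.single k p.2.2) (I · p.1) (X · p.1) (r + 1) := by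
  simp only [expWeight_single_add_single _ _ _ _ hik]
  exact (measurable_ofReal_exp_mul_sub (h.measurable_devSum μ r i) (h.measurable_pulls r i)
    measurable_fst).mul (measurable_ofReal_exp_mul_sub (h.measurable_devSum μ r k)
    (h.measurable_pulls r k) measurable_snd)

variable [IsProbabilityMeasure P] [∀ k, IsProbabilityMeasure (ν k)]

theorem IsEBTC.hasCondDistrib_reward (h : IsEBTC P ν ε₀ β 𝓕 I X B C) {t : ℕ} {S : Type*}
    [MeasurableSpace S] {V : Ω → S} (hV : Measurable[𝓕 t] V) :
    HasCondDistrib (X (t + 1)) (fun ω => (V ω, I (t + 1) ω))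
      ((Kernel.ofFunOfCountable ν).prodMkLeft S) P := by
  have : IsMarkovKernel (Kernel.ofFunOfCountable ν) :=
    ⟨fun k => inferInstanceAs (IsProbabilityMeasure (ν k))⟩
  exact hasCondDistrib_of_condExp (𝓕.le t) (hV.prodMk (h.measurable_arm t))
    ((h.measurable_reward t).mono (𝓕.le _) le_rfl) (h.reward_law t)

theorem IsEBTC.setLIntegral_mul_reward_le (h : IsEBTC P ν ε₀ β 𝓕 I X B C) {t : ℕ}
    {g : Fin K → ℝ → ENNReal} (hg : ∀ k, Measurable (g k)) (hg_one : ∀ k, ∫⁻ y, g k y ∂ν k ≤ 1)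
    {W : Ω → ENNReal} (hW : Measurable[𝓕 t] W) {A : Set Ω} (hA : MeasurableSet[𝓕 t] A) :
    ∫⁻ ω in A, W ω * g (I (t + 1) ω) (X (t + 1) ω) ∂P ≤ ∫⁻ ω in A, W ω ∂P := by
  have : IsMarkovKernel (Kernel.ofFunOfCountable ν) :=
    ⟨fun k => inferInstanceAs (IsProbabilityMeasure (ν k))⟩
  have hA' := 𝓕.le t A hA
  have hg' : Measurable fun p : (ENNReal × Fin K) × ℝ => p.1.1 * g p.1.2 p.2 :=
    (measurable_fst.comp measurable_fst).mul
      ((measurable_from_prod_countable_right (f := fun q : Fin K × ℝ => g q.1 q.2) hg).comp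
        ((measurable_snd.comp measurable_fst).prodMk measurable_snd))
  calc ∫⁻ ω in A, W ω * g (I (t + 1) ω) (X (t + 1) ω) ∂P
      = ∫⁻ ω, A.indicator W ω * g (I (t + 1) ω) (X (t + 1) ω) ∂P := by
        rw [← lintegral_indicator hA']
        simp only [Set.indicator_mul_left]
    _ = ∫⁻ ω, ∫⁻ y, A.indicator W ω * g (I (t + 1) ω) y ∂ν (I (t + 1) ω) ∂P :=
        lintegral_eq_lintegral_lintegral_of_hasCondDistrib
          (h.hasCondDistrib_reward (hW.indicator hA)) hg'
    _ ≤ ∫⁻ ω, A.indicator W ω ∂P := by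
        refine lintegral_mono fun ω => ?_
        rw [lintegral_const_mul _ (hg _)]
        exact mul_le_of_le_one_right' (hg_one _)
    _ = ∫⁻ ω in A, W ω ∂P := lintegral_indicator hA' W

theorem IsEBTC.eSupermartingale_expWeight (h : IsEBTC P ν ε₀ β 𝓕 I X B C)
    (hsub : ∀ k, IsOneSubGaussian (ν k)) (l : Fin K → ℝ) :
    ESupermartingale (fun r ω => expWeight (armMean ν) l (I · ω) (X · ω) (r + 1)) 𝓕 P where
  measurable := h.measurable_expWeight _ _
  setLIntegral_succ_le r A hA := by
    simp only [expWeight_succ _ _ _ _ _ (Nat.le_add_left 1 r)]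
    exact h.setLIntegral_mul_reward_le
      (g := fun k y => ENNReal.ofReal (Real.exp (l k * (y - armMean ν k) - l k ^ 2 / 2)))
      (fun _ => by fun_prop) (fun k => (hsub k).lintegral_exp_le_one (l k))
      (h.measurable_expWeight _ _ r) hA

theorem IsEBTC.measure_inaccurateNear_le (h : IsEBTC P ν ε₀ β 𝓕 I X B C)
    (hsub : ∀ k, IsOneSubGaussian (ν k)) {i k : Fin K} (hik : i ≠ k) {x a b : ℝ} (hx : 1 < x)
    (ha : 0 < a) (hb : 0 < b) :
    P {ω | InaccurateNear (armMean ν) x (I · ω) (X · ω) i k a b}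
      ≤ ENNReal.ofReal (Real.exp 2 * (x * Real.exp (-x))) := by
  set bound := ENNReal.ofReal (Real.exp 2 * (x * Real.exp (-x)))
  set ρ := (gaussianReal 0 ((x - 1) / a).toNNReal).prod (gaussianReal 0 ((x - 1) / b).toNNReal)
  set Z : ℕ → Ω → ENNReal := fun r ω => ∫⁻ p, expWeight (armMean ν)
    (Pi.single i p.1 + Pi.single k p.2) (I · ω) (X · ω) (r + 1) ∂ρ
  have hZ : ESupermartingale Z 𝓕 P := ESupermartingale.lintegral
    (fun _ => h.eSupermartingale_expWeight hsub _)
    (h.measurable_expWeight_single_add_single _ hik)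
  have hZ_zero : ∫⁻ ω, Z 0 ω ∂P = 1 := by simp [Z, expWeight_one]
  have hville : P {ω | ∃ r, bound⁻¹ ≤ Z r ω} ≤ bound := by
    rw [← ENNReal.inv_le_inv, ENNReal.le_inv_iff_mul_le, ← hZ_zero]
    exact hZ.mul_measure_exists_le _
  refine (measure_mono ?_).trans hville
  rintro ω ⟨t, hi, hk, hdev⟩
  have ht : t ≠ 0 := by
    rintro rfl
    exact ha.not_ge (hi.1.trans_eq (by simp [pulls]))
  obtain ⟨r, rfl⟩ := Nat.exists_eq_succ_of_ne_zero ht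
  rw [sqDev_eq_sq_div, sqDev_eq_sq_div] at hdev
  refine ⟨r, (inv_le_lintegral_mul_lintegral_exp_gaussianReal hx ha hb hi hk hdev).trans_eq ?_⟩
  simp only [Z, expWeight_single_add_single _ _ _ _ hik]
  exact (lintegral_prod_mul (by fun_prop) (by fun_prop)).symm

end Deviation

section UnionBound

theorem exists_mem_Icc_exp {N n : ℝ} (hN : 1 ≤ N) (hNn : N ≤ n) :
    ∃ u ∈ Finset.range (⌊Real.log n⌋₊ + 1), N ∈ Set.Icc (Real.exp u) (Real.exp 1 * Real.exp u) := by
  have hN₀ : 0 < N := one_pos.trans_le hN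
  refine ⟨⌊Real.log N⌋₊, Finset.mem_range_succ_iff.2 ?_, ?_, ?_⟩
  · exact Nat.floor_le_floor (Real.log_le_log hN₀ hNn)
  · exact (Real.le_log_iff_exp_le hN₀).1 (Nat.floor_le (Real.log_nonneg hN))
  · rw [← Real.exp_add, ← Real.log_le_iff_le_exp hN₀, add_comm]
    exact (Nat.lt_floor_add_one _).le

variable {K : ℕ} {ε₀ β x : ℝ} {n : ℕ}

/-- The pairs of distinct arms, together with a pair of exponential scales up to `n`. -/
noncomputable def slices (K n : ℕ) : Finset ((Fin K × Fin K) × ℕ × ℕ) :=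
  Finset.univ.offDiag ×ˢ Finset.range (⌊Real.log n⌋₊ + 1) ×ˢ Finset.range (⌊Real.log n⌋₊ + 1)

theorem card_slices_le (hn : 1 ≤ n) :
    ((slices K n).card : ℝ) ≤ K ^ 2 * (2 + Real.log n) ^ 2 := by
  have hpairs : ((Finset.univ : Finset (Fin K)).offDiag.card : ℝ) ≤ K ^ 2 := by
    rw [Finset.offDiag_card, Finset.card_univ, Fintype.card_fin, sq, ← Nat.cast_mul]
    exact Nat.cast_le.2 (Nat.sub_le _ _)
  have hscales : ((⌊Real.log n⌋₊ + 1 : ℕ) : ℝ) ≤ 2 + Real.log n := by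
    have := Nat.floor_le (Real.log_nonneg (Nat.one_le_cast.2 hn))
    push_cast
    linarith
  rw [slices, Finset.card_product, Finset.card_product, Finset.card_range, Nat.cast_mul,
    Nat.cast_mul, ← sq (_ : ℝ)]
  gcongr

theorem IsRun.exists_mem_slices {μ : Fin K → ℝ} {I : ℕ → Fin K} {X : ℕ → ℝ} {B C : ℕ → Fin K}
    (h : IsRun ε₀ β I X B C) (hA : ¬ ∀ t ∈ Finset.Icc (K + 1) n, Accurate μ x I X t) :
    ∃ p ∈ slices K n,
      InaccurateNear μ x I X p.1.1 p.1.2 (Real.exp p.2.1) (Real.exp p.2.2) := by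
  simp only [Accurate, not_forall, not_lt] at hA
  obtain ⟨t, ht, i, k, hik, hdev⟩ := hA
  obtain ⟨hKt, htn⟩ := Finset.mem_Icc.1 ht
  have hscale := fun a => exists_mem_Icc_exp
    (Nat.one_le_cast.2 (h.one_le_pulls hKt a) : (1 : ℝ) ≤ pulls I t a)
    (Nat.cast_le.2 ((pulls_le I t a).trans ((Nat.sub_le t 1).trans htn)) : _ ≤ (n : ℝ))
  obtain ⟨u, hu, hui⟩ := hscale i
  obtain ⟨v, hv, hvk⟩ := hscale k
  exact ⟨((i, k), (u, v)), by simp_all [slices], t, hui, hvk, hdev⟩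

variable {Ω : Type*} [mΩ : MeasurableSpace Ω] {P : Measure Ω} [IsProbabilityMeasure P]
  {ν : Fin K → Measure ℝ} [∀ k, IsProbabilityMeasure (ν k)] {𝓕 : Filtration ℕ mΩ}
  {I : ℕ → Ω → Fin K} {X : ℕ → Ω → ℝ} {B C : ℕ → Ω → Fin K}

theorem IsEBTC.measure_not_accurate_le (h : IsEBTC P ν ε₀ β 𝓕 I X B C)
    (hsub : ∀ k, IsOneSubGaussian (ν k)) (hx : 1 < x) (hn : 1 ≤ n) :
    P {ω | ¬ ∀ t ∈ Finset.Icc (K + 1) n, Accurate (armMean ν) x (I · ω) (X · ω) t}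
      ≤ ENNReal.ofReal (K ^ 2 * Real.exp 2 * (2 + Real.log n) ^ 2 * (x * Real.exp (-x))) := by
  set near : (Fin K × Fin K) × ℕ × ℕ → Set Ω := fun p =>
    {ω | InaccurateNear (armMean ν) x (I · ω) (X · ω) p.1.1 p.1.2 (Real.exp p.2.1)
      (Real.exp p.2.2)}
  have hcover : {ω | ¬ ∀ t ∈ Finset.Icc (K + 1) n, Accurate (armMean ν) x (I · ω) (X · ω) t}
      ≤ᵐ[P] ⋃ p ∈ slices K n, near p := by
    filter_upwards [h.run] with ω hrun hω
    obtain ⟨p, hp, hnear⟩ := hrun.exists_mem_slices hω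
    exact Set.mem_iUnion₂_of_mem hp hnear
  calc P {ω | ¬ ∀ t ∈ Finset.Icc (K + 1) n, Accurate (armMean ν) x (I · ω) (X · ω) t}
      ≤ ∑ p ∈ slices K n, P (near p) :=
        (measure_mono_ae hcover).trans (measure_biUnion_finset_le _ _)
    _ ≤ ∑ _ ∈ slices K n, ENNReal.ofReal (Real.exp 2 * (x * Real.exp (-x))) := by
        refine Finset.sum_le_sum fun p hp => ?_
        exact h.measure_inaccurateNear_le hsub
          (Finset.mem_offDiag.1 (Finset.mem_product.1 hp).1).2.2 hx (Real.exp_pos _)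
          (Real.exp_pos _)
    _ = ENNReal.ofReal ((slices K n).card * (Real.exp 2 * (x * Real.exp (-x)))) := by
        rw [Finset.sum_const, nsmul_eq_mul, ENNReal.ofReal_mul (Nat.cast_nonneg _),
          ENNReal.ofReal_natCast]
    _ ≤ ENNReal.ofReal
          (K ^ 2 * (2 + Real.log n) ^ 2 * (Real.exp 2 * (x * Real.exp (-x)))) := by
        gcongr
        exact card_slices_le hn
    _ = _ := by ring_nf

end UnionBound

theorem exp_neg_pFun {x : ℝ} (hx : 0 < x) : Real.exp (-pFun x) = x * Real.exp (-x) := by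
  rw [pFun, neg_sub, sub_eq_add_neg, Real.exp_add, Real.exp_log hx]

theorem lt_of_five_mul_sq_div_two_lt {K n : ℕ} (hn : 5 * (K : ℝ) ^ 2 / 2 < n) : K < n := by
  have hK : (K : ℝ) ≤ K ^ 2 := by exact_mod_cast Nat.le_self_pow two_ne_zero K
  exact Nat.cast_lt.1 (by linarith [sq_nonneg (K : ℝ)] : (K : ℝ) < n)

section Regret

variable {K : ℕ} {Ω : Type*} [mΩ : MeasurableSpace Ω] {P : Measure Ω} [IsProbabilityMeasure P]
  {ν : Fin K → Measure ℝ} [∀ k, IsProbabilityMeasure (ν k)] {ε₀ : ℝ} {𝓕 : Filtration ℕ mΩ}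
  {I : ℕ → Ω → Fin K} {X : ℕ → Ω → ℝ} {B C : ℕ → Ω → Fin K} [NeZero K]

theorem IsEBTC.measureReal_gap_le_regret_le (h : IsEBTC P ν ε₀ (1 / 2) 𝓕 I X B C) (hε : 0 < ε₀)
    (hsub : ∀ k, IsOneSubGaussian (ν k)) {n : ℕ} (hn : 5 * (K : ℝ) ^ 2 / 2 < n) {i : ℕ}
    (h_one : 1 ≤ i) (hi : i < numClasses (armMean ν)) :
    P.real {ω | gap (armMean ν) (i + 1) ≤ bestMean (armMean ν) - armMean ν (B n ω)}
      ≤ K ^ 2 * Real.exp 2 * (2 + Real.log n) ^ 2 * Real.exp (-pFun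
        (max 1 ((n - 5 * (K : ℝ) ^ 2 / 2) / (8 * complexity (armMean ν) ε₀ i)))) := by
  have hKn := lt_of_five_mul_sq_div_two_lt hn
  have hn_one : 1 ≤ n := by lia
  have hlog : 0 ≤ Real.log n := Real.log_nonneg (Nat.one_le_cast.2 hn_one)
  have hK : (1 : ℝ) ≤ K := Nat.one_le_cast.2 (NeZero.pos K)
  have hH := complexity_pos (armMean ν) hε h_one hi
  set x := (n - 5 * (K : ℝ) ^ 2 / 2) / (8 * complexity (armMean ν) ε₀ i) with hx_def
  rcases le_or_gt x 1 with hx | hx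
  · rw [max_eq_left hx, exp_neg_pFun one_pos, one_mul, mul_right_comm, mul_assoc _ (Real.exp 2),
      ← Real.exp_add]
    have h_exp : 1 ≤ Real.exp (2 + -1) := Real.one_le_exp (by norm_num)
    calc P.real _ ≤ 1 := measureReal_le_one
      _ ≤ K ^ 2 * Real.exp (2 + -1) * (2 + Real.log n) ^ 2 :=
        one_le_mul_of_one_le_of_one_le (one_le_mul_of_one_le_of_one_le (one_le_pow₀ hK) h_exp)
          (one_le_pow₀ (by linarith))
  · have hx₀ : 0 < x := one_pos.trans hx
    rw [max_eq_right hx.le, exp_neg_pFun hx₀]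
    refine ENNReal.toReal_le_of_le_ofReal (by positivity) ?_
    refine (measure_mono_ae ?_).trans (h.measure_not_accurate_le hsub hx hn_one)
    filter_upwards [h.run] with ω hrun hgap hA
    refine hgap.not_gt (hrun.regret_lt_gap ⟨by norm_num, by norm_num⟩ hε hKn hx₀.le hA h_one hi ?_)
    have hxH : 8 * x * complexity (armMean ν) ε₀ i = n - 5 * (K : ℝ) ^ 2 / 2 := by
      rw [hx_def]
      field_simp
    norm_num
    nlinarith

theorem IsEBTC.integral_regret_le (h : IsEBTC P ν ε₀ (1 / 2) 𝓕 I X B C) (hε : 0 < ε₀)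
    (hsub : ∀ k, IsOneSubGaussian (ν k)) {n : ℕ} (hn : 5 * (K : ℝ) ^ 2 / 2 < n) :
    ∫ ω, (bestMean (armMean ν) - armMean ν (B n ω)) ∂P ≤
      K ^ 2 * Real.exp 2 * (2 + Real.log n) ^ 2 *
        ∑ i ∈ Finset.Icc 1 (numClasses (armMean ν) - 1),
          (gap (armMean ν) (i + 1) - gap (armMean ν) i) * Real.exp (-pFun
            (max 1 ((n - 5 * (K : ℝ) ^ 2 / 2) / (8 * complexity (armMean ν) ε₀ i)))) := by
  set μ := armMean ν
  set bad : ℕ → Set Ω := fun i => {ω | gap μ (i + 1) ≤ bestMean μ - μ (B n ω)}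
  have hn_ne : n ≠ 0 := (Nat.zero_le K).trans_lt (lt_of_five_mul_sq_div_two_lt hn) |>.ne'
  obtain ⟨q, rfl⟩ := Nat.exists_eq_succ_of_ne_zero hn_ne
  have hbad : ∀ i, MeasurableSet (bad i) := fun i => (h.measurable_leader q).mono (𝓕.le q) le_rfl
    (Set.toFinite {k | gap μ (i + 1) ≤ bestMean μ - μ k}).measurableSet
  have hregret : ∀ ω, bestMean μ - μ (B (q + 1) ω) = ∑ i ∈ Finset.Icc 1 (numClasses μ - 1),
      (gap μ (i + 1) - gap μ i) * (bad i).indicator 1 ω := fun ω => by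
    rw [regret_eq_sum_gap_sub]
    simp only [bad, Set.indicator_apply, Set.mem_ofPred_eq, Pi.one_apply]
  calc ∫ ω, (bestMean μ - μ (B (q + 1) ω)) ∂P
      = ∑ i ∈ Finset.Icc 1 (numClasses μ - 1), (gap μ (i + 1) - gap μ i) * P.real (bad i) := by
        simp only [hregret]
        rw [integral_finsetSum _ fun i _ =>
          ((integrable_const 1).indicator (hbad i)).const_mul _]
        simp only [integral_const_mul, integral_indicator_one (hbad _)]
    _ ≤ _ := by
        rw [Finset.mul_sum]
        refine Finset.sum_le_sum fun i hi => ?_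
        obtain ⟨h_one, hi⟩ := Finset.mem_Icc.1 hi
        rw [mul_left_comm]
        gcongr
        · exact sub_nonneg.2 (gap_strictMonoOn μ |>.monotoneOn ⟨h_one, by lia⟩
            ⟨by lia, by lia⟩ i.le_succ)
        · exact h.measureReal_gap_le_regret_le hε hsub hn h_one (by lia)

end Regret

end EBTC

theorem corollary1 {K : ℕ} (hK : 2 ≤ K) {ε₀ : ℝ} (hε₀ : 0 < ε₀)
    (ν : Fin K → Measure ℝ) (hν : ∀ k, IsProbabilityMeasure (ν k))
    (hsub : ∀ k, EBTC.IsOneSubGaussian (ν k))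
    (μ : Fin K → ℝ) (hμ : μ = EBTC.armMean ν)
    {Ω : Type*} [mΩ : MeasurableSpace Ω] (P : Measure Ω) [IsProbabilityMeasure P]
    (𝓕 : Filtration ℕ mΩ)
    (I : ℕ → Ω → Fin K) (X : ℕ → Ω → ℝ) (B C : ℕ → Ω → Fin K)
    (hrun : EBTC.IsEBTC P ν ε₀ (1 / 2) 𝓕 I X B C) :
    -- the complexities
    (2 ≤ EBTC.numClasses μ →
      EBTC.complexity μ ε₀ 1 = K * (2 / EBTC.gap μ 2 + 3 / ε₀) ^ 2) ∧
    (∀ i ∈ Finset.Icc 2 (EBTC.numClasses μ - 1),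
      2 * K / EBTC.gap μ (i + 1) ^ 2 ≤ EBTC.complexity μ ε₀ i ∧
      ∀ j ∈ Finset.Icc 1 i, EBTC.complexity μ ε₀ i ≤
        3 / 2 * (K * (max (2 / EBTC.gap μ (j + 1))
          (2 * ((EBTC.gap μ j / ε₀ + 1) / (EBTC.gap μ (i + 1) - EBTC.gap μ j))
            + 3 / ε₀)) ^ 2)) ∧
    -- the bound on the expected simple regret
    (∀ n : ℕ, 5 * (K : ℝ) ^ 2 / 2 < n →
      ∫ ω, (EBTC.bestMean μ - μ (B n ω)) ∂P ≤
        (K : ℝ) ^ 2 * Real.exp 2 * (2 + Real.log n) ^ 2 *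
          ∑ i ∈ Finset.Icc 1 (EBTC.numClasses μ - 1),
            (EBTC.gap μ (i + 1) - EBTC.gap μ i) *
              Real.exp (-EBTC.pFun
                (max 1 ((n - 5 * (K : ℝ) ^ 2 / 2) / (8 * EBTC.complexity μ ε₀ i))))) ∧
    (∀ n : ℕ, 5 * (K : ℝ) ^ 2 / 2 < n →
      (∀ i ∈ Finset.Icc 1 (EBTC.numClasses μ - 1),
        5 * (K : ℝ) ^ 2 / 2 + 8 * EBTC.complexity μ ε₀ i ≤ n) →
      ∫ ω, (EBTC.bestMean μ - μ (B n ω)) ∂P ≤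
        (K : ℝ) ^ 2 * Real.exp 2 * (2 + Real.log n) ^ 2 *
          ∑ i ∈ Finset.Icc 1 (EBTC.numClasses μ - 1),
            (EBTC.gap μ (i + 1) - EBTC.gap μ i) *
              Real.exp (-EBTC.pFun
                ((n - 5 * (K : ℝ) ^ 2 / 2) / (8 * EBTC.complexity μ ε₀ i)))) := by
  subst hμ
  have : NeZero K := ⟨by lia⟩
  refine ⟨EBTC.complexity_one _ hε₀, fun i hi => ?_,
    fun n hn => hrun.integral_regret_le hε₀ hsub hn,
    fun n hn hH => (hrun.integral_regret_le hε₀ hsub hn).trans_eq ?_⟩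
  · rw [Finset.mem_Icc] at hi
    exact ⟨EBTC.le_complexity _ hε₀ (by lia) (by lia), fun j hj =>
      EBTC.complexity_le_mul _ hε₀ hj (by lia)⟩
  · congr 1
    refine Finset.sum_congr rfl fun i hi => ?_
    have hi' := Finset.mem_Icc.1 hi
    have hpos := EBTC.complexity_pos (EBTC.armMean ν) hε₀ hi'.1 (by lia)
    rw [max_eq_right ((one_le_div₀ (by positivity)).2 (by linarith [hH i hi]))]
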